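/- **Conventions.** Spaces are compactly generated topological spaces, and products and mapping spaces $Y^X$ are formed in the category of compactly generated spaces. A $\mathbf{Top}_*$-category $\mathcal T$ is a category enriched in pointed spaces with the smash product: each mapping space $\mathcal T(A,B)$ is a space with a basepoint $0$, and composition $\mathcal T(B,C)\times\mathcal T(A,B)\to\mathcal T(A,C)$, $(x,y)\mapsto xy$, is continuous with $0y=0$ and $x0=0$. It is *left linear* if every $\mathcal T(A,B)$ is a (not necessarily commutative) topological monoid, written additively, with neutral element the basepoint $0$, and $(x+x')y=xy+x'y$ always holds. It is a *mapping theory* if it is small and has all finite products (in the enriched sense: $\mathcal T(X,\prod_i A_i)\to\prod_i\mathcal T(X,A_i)$ is a homeomorphism). A left linear mapping theory is *weakly bilinear* if for all objects $A,B,Z$ the map $$(i_A^*,i_B^*)\colon \mathcal T(A\times B,Z)\to\mathcal T(A,Z)\times\mathcal T(B,Z)$$ is a trivial Serre fibration (a Serre fibration and a weak homotopy equivalence), where $i_A=(1_A,0)$ and $i_B=(0,1_B)$. A space $L$ is *Serre cofibrant* if $\emptyset\to L$ has the left lifting property with respect to all trivial Serre fibrations (equivalently, $L$ is a retract of a cell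 complex). Let $I=[0,1]$. For cubes $b\colon I^p\to M$, $c\colon I^q\to M$ in a topological monoid $M$, let $b\oplus c\colon I^{p+q}=I^p\times I^q\to M$ be $(s,t)\mapsto b(s)+c(t)$. An *$\infty$-distributor* for a left linear $\mathbf{Top}_*$-category $\mathcal T$ is a family of cubes $$\varphi_a^{x_0,\dots,x_n}\colon I^n\to\mathcal T(X,B),$$ one for each $n\ge 0$, all objects $X,A,B$, and all $a\in\mathcal T(A,B)$, $x_0,\dots,x_n\in\mathcal T(X,A)$, such that 1. $\varphi_a^{x}=ax$ for $n=0$; 2. for all $n\ge1$ and $1\le j\le n$, $$\varphi_a^{x_0,\dots,x_n}(t_1,\dots,t_n)=\begin{cases}\varphi_a^{x_0,\dots,x_{j-1}+x_j,\dots,x_n}(t_1,\dots,\widehat{t_j},\dots,t_n)&\text{if }t_j=0,\\ \bigl(\varphi_a^{x_0,\dots,x_{j-1}}\oplus\varphi_a^{x_j,\dots,x_n}\bigr)(t_1,\dots,\widehat{t_j},\dots,t_n)&\text{if }t_j=1;\end{cases}$$ 3. for all $n\ge0$ and all $X,A,B$, the map $\mathcal T(A,B)\times\mathcal T(X,A)^{n+1}\to\mathcal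 T(X,B)^{I^n}$, $(a,x_0,\dots,x_n)\mapsto\varphi_a^{x_0,\dots,x_n}$, is continuous. In particular, the cube $\varphi_a^{x_0,\dots,x_n}$ has the vertices $a(x_0+\dots+x_n)$ at $(0,\dots,0)$ and $ax_0+\dots+ax_n$ at $(1,\dots,1)$. If $\mathcal T$ has finite products, an $\infty$-distributor is *good* if for every $n\ge0$ it satisfies * (*universality*) $\varphi_a^{x_0,\dots,x_n}(t)=\varphi_a^{p_0,\dots,p_n}(t)\circ(x_0,\dots,x_n)$ for all $a\in\mathcal T(A,B)$, $x_i\in\mathcal T(X,A)$ and $t\in I^n$, where $p_0,\dots,p_n\colon A^{n+1}\to A$ are the projections; * (*wedge condition*) for all $a\in\mathcal T(A,B)$, $x\in\mathcal T(X,A)$ and $0\le k\le n$, the cube $\varphi_a^{0,\dots,x,\dots,0}$ with $x$ in position $k$ is the constant $n$-cube at $ax$. **Theorem.** Let $\mathcal T$ be a weakly bilinear mapping theory in which every mapping space $\mathcal T(A,B)$ is Serre cofibrant. Then $\mathcal T$ admits a good $\infty$-distributor. -/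

import Mathlib

open CategoryTheory CategoryTheory.Limits
open scoped unitInterval Topology

universe v u

/-! ### Continuity in the category of compactly generated spaces -/

/-- `f` is continuous for the compactly generated topology (the k-ification) on its domain.
For `X` a product of spaces, this is continuity on the product formed in the category of compactly
generated spaces. -/
def CGContinuous {X Y : Type v} [TopologicalSpace X] [tY : TopologicalSpace Y] (f : X → Y) : Prop :=
  Continuous[TopologicalSpace.compactlyGenerated.{v} X, tY] f

theorem CGContinuous.comp_continuous {K X Y : Type v} [TopologicalSpace K] [TopologicalSpace X]
    [TopologicalSpace Y] [CompactlyGeneratedSpace K] {f : X → Y} (hf : CGContinuous f)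
    {g : K → X} (hg : Continuous g) : Continuous (f ∘ g) := by
  refine continuous_from_uCompactlyGeneratedSpace.{v} _ fun S h => ?_
  have hf' := continuous_coinduced_dom.1 hf
  exact (continuous_sigma_iff.1 hf') ⟨S, ⟨g ∘ h, hg.comp h.continuous⟩⟩

/-! ### Serre fibrations, weak equivalences, Serre cofibrant spaces -/

/-- Serre fibrations: the homotopy lifting property for all cubes. -/
def IsSerreFibration {E B : Type v} [TopologicalSpace E] [TopologicalSpace B] (p : C(E, B)) : Prop :=
  ∀ (n : ℕ) (H : C((Fin n → I) × I, B)) (f : C(Fin n → I, E)),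
    (∀ s, p (f s) = H (s, 0)) →
    ∃ G : C((Fin n → I) × I, E), (∀ s, G (s, 0) = f s) ∧ ∀ z, p (G z) = H z

/-- The map induced by `f` on the `n`-th homotopy group (the set of path components if `n = 0`). -/
def homotopyGroupMap {X Y : Type v} [TopologicalSpace X] [TopologicalSpace Y] (f : C(X, Y)) (n : ℕ)
    (x : X) : HomotopyGroup.Pi n X x → HomotopyGroup.Pi n Y (f x) :=
  Quotient.map (fun γ => ⟨f.comp γ.1, fun y hy => congrArg f (γ.2 y hy)⟩)
    fun _ _ h => h.map fun H => H.compContinuousMap f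

/-- Weak homotopy equivalences: bijections on path components and on all homotopy groups at all
basepoints. (The first clause is the part of bijectivity on path components that is not seen by a
choice of basepoint in `X`.) -/
def IsWeakHomotopyEquiv {X Y : Type v} [TopologicalSpace X] [TopologicalSpace Y] (f : C(X, Y)) :
    Prop :=
  (Nonempty Y → Nonempty X) ∧ ∀ (n : ℕ) (x : X), Function.Bijective (homotopyGroupMap f n x)

/-- Trivial (Serre) fibrations. -/
def IsTrivialSerreFibration {E B : Type v} [TopologicalSpace E] [TopologicalSpace B] (p : C(E, B)) :
    Prop :=
  IsSerreFibration p ∧ IsWeakHomotopyEquiv p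

/-- Serre cofibrant spaces: `∅ → L` has the left lifting property with respect to all trivial Serre
fibrations. Equivalently, `L` is a retract of a cell complex. -/
def IsSerreCofibrant (L : Type v) [TopologicalSpace L] : Prop :=
  ∀ (E B : Type v) [TopologicalSpace E] [TopologicalSpace B] (p : C(E, B)),
    IsTrivialSerreFibration p → ∀ g : C(L, B), ∃ f : C(L, E), ∀ l, p (f l) = g l

/-! ### Categories enriched in pointed spaces -/

/-- A category enriched in pointed compactly generated spaces (with the smash product): mapping
spaces are compactly generated and pointed by the zero morphisms, and composition is continuous on
the compactly generated product and satisfies `0 y = 0` and `x 0 = 0`.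

Composition is written in diagrammatic order: the composite `a x` is `x ≫ a`. -/
class PointedTopCategory (T : Type u) [Category.{v} T] extends HasZeroMorphisms T where
  homTopology : ∀ X Y : T, TopologicalSpace (X ⟶ Y)
  homCompactlyGenerated : ∀ X Y : T, CompactlyGeneratedSpace (X ⟶ Y)
  continuous_comp : ∀ X Y Z : T, CGContinuous fun q : (X ⟶ Y) × (Y ⟶ Z) => q.1 ≫ q.2

attribute [reducible] PointedTopCategory.homTopology

attribute [instance] PointedTopCategory.homTopology PointedTopCategory.homCompactlyGenerated

/-- Left linear categories: mapping spaces are topological monoids (not assumed commutative) in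
compactly generated spaces, with the basepoint `0` as neutral element, and
`(x + x') y = x y + x' y`. -/
class LeftLinearTopCategory (T : Type u) [Category.{v} T] extends PointedTopCategory T where
  homAdd : ∀ {X Y : T}, (X ⟶ Y) → (X ⟶ Y) → (X ⟶ Y)
  homAdd_assoc : ∀ {X Y : T} (x y z : X ⟶ Y), homAdd (homAdd x y) z = homAdd x (homAdd y z)
  zero_homAdd : ∀ {X Y : T} (x : X ⟶ Y), homAdd 0 x = x
  homAdd_zero : ∀ {X Y : T} (x : X ⟶ Y), homAdd x 0 = x
  continuous_homAdd : ∀ X Y : T, CGContinuous fun q : (X ⟶ Y) × (X ⟶ Y) => homAdd q.1 q.2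
  comp_homAdd : ∀ {X Y Z : T} (y : X ⟶ Y) (x x' : Y ⟶ Z),
    y ≫ homAdd x x' = homAdd (y ≫ x) (y ≫ x')

instance LeftLinearTopCategory.instAddHom {T : Type u} [Category.{v} T]
    [LeftLinearTopCategory T] (X Y : T) : Add (X ⟶ Y) := ⟨homAdd⟩

instance LeftLinearTopCategory.instAddMonoidHom {T : Type u} [Category.{v} T]
    [LeftLinearTopCategory T] (X Y : T) : AddMonoid (X ⟶ Y) where
  toAdd := LeftLinearTopCategory.instAddHom X Y
  add_assoc := homAdd_assoc
  zero := 0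
  zero_add := zero_homAdd
  add_zero := homAdd_zero
  nsmul := nsmulRec

section Products

variable {T : Type u} [Category.{v} T] [PointedTopCategory T]

/-- `P` with projections `p i` is a product of the `A i` in the enriched sense: for every `X`, the
map `T(X, P) → ∏ i, T(X, A i)` is a homeomorphism onto the product of compactly generated spaces. -/
def IsEnrichedProduct {n : ℕ} (A : Fin n → T) (P : T) (p : ∀ i, P ⟶ A i) : Prop :=
  ∀ X : T, @IsHomeomorph (X ⟶ P) (∀ i, X ⟶ A i) _
    (TopologicalSpace.compactlyGenerated.{v} (∀ i, X ⟶ A i)) fun f i => f ≫ p i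

/-- `P` with projections `pA`, `pB` is a product of `A` and `B` in the enriched sense. -/
def IsEnrichedBinaryProduct {A B : T} (P : T) (pA : P ⟶ A) (pB : P ⟶ B) : Prop :=
  ∀ X : T, @IsHomeomorph (X ⟶ P) ((X ⟶ A) × (X ⟶ B)) _
    (TopologicalSpace.compactlyGenerated.{v} ((X ⟶ A) × (X ⟶ B))) fun f => (f ≫ pA, f ≫ pB)

variable (T) in
/-- All finite products (including the empty one) exist. -/
def HasEnrichedFiniteProducts : Prop :=
  ∀ (n : ℕ) (A : Fin n → T), ∃ (P : T) (p : ∀ i, P ⟶ A i), IsEnrichedProduct A P p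

theorem PointedTopCategory.continuous_precomp {A P : T} (i : A ⟶ P) (Z : T) :
    Continuous fun f : P ⟶ Z => i ≫ f :=
  (continuous_comp A P Z).comp_continuous (continuous_const.prodMk continuous_id)

/-- The map `(iA^*, iB^*) : T(P, Z) → T(A, Z) × T(B, Z)`. (The target carries the product topology;
its k-ification receives the same maps from cubes, so that it makes no difference to the notion of
trivial Serre fibration.) -/
def restrictionMap {A B P : T} (iA : A ⟶ P) (iB : B ⟶ P) (Z : T) :
    C(P ⟶ Z, (A ⟶ Z) × (B ⟶ Z)) :=
  ⟨fun f => (iA ≫ f, iB ≫ f), (PointedTopCategory.continuous_precomp iA Z).prodMk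
    (PointedTopCategory.continuous_precomp iB Z)⟩

end Products

/-- A weakly bilinear mapping theory: a left linear category with finite products such that, for
all `A`, `B`, `Z`, restriction along the inclusions `iA = (1, 0)` and `iB = (0, 1)`,
`T(A × B, Z) → T(A, Z) × T(B, Z)`, is a trivial Serre fibration. -/
structure IsWeaklyBilinearMappingTheory (T : Type u) [Category.{v} T] [LeftLinearTopCategory T] : Prop where
  hasFiniteProducts : HasEnrichedFiniteProducts T
  trivialFibration : ∀ (A B Z P : T) (pA : P ⟶ A) (pB : P ⟶ B), IsEnrichedBinaryProduct P pA pB →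
    ∀ (iA : A ⟶ P) (iB : B ⟶ P), iA ≫ pA = 𝟙 A → iA ≫ pB = 0 → iB ≫ pA = 0 → iB ≫ pB = 𝟙 B →
      IsTrivialSerreFibration (restrictionMap iA iB Z)

/-! ### Distributors -/

/-- An `∞`-distributor: `cube n a x` is the `n`-cube `φ_a^{x_0, …, x_n}` in `T(X, B)`. -/
structure InftyDistributor (T : Type u) [Category.{v} T] [LeftLinearTopCategory T] where
  cube : ∀ (n : ℕ) {X A B : T}, (A ⟶ B) → (Fin (n + 1) → (X ⟶ A)) → C(Fin n → I, X ⟶ B)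
  /-- `φ_a^{x} = a x`. -/
  cube_zero : ∀ {X A B : T} (a : A ⟶ B) (x : Fin 1 → (X ⟶ A)) (t : Fin 0 → I),
    cube 0 a x t = x 0 ≫ a
  /-- The boundary condition at `t_j = 0`: two adjacent inputs are added and the coordinate is
  dropped. (Coordinates are numbered from `0` here, so the inputs `j` and `j + 1` are added.) -/
  cube_of_eq_zero : ∀ (n : ℕ) {X A B : T} (a : A ⟶ B) (x : Fin (n + 2) → (X ⟶ A))
    (t : Fin (n + 1) → I) (j : Fin (n + 1)), t j = 0 →
      cube (n + 1) a x t = cube n a (j.castSucc.contractNth (· + ·) x) (j.removeNth t)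
  /-- The boundary condition at `t_j = 1`: the cube is the external sum of `φ_a^{x_0, …, x_p}` and
  `φ_a^{x_{p+1}, …, x_{p+q+1}}`. The dimension is written as `p + q + 1`, where `p` coordinates come
  before the one that is equal to `1`, and `q` after it. -/
  cube_of_eq_one : ∀ (p q : ℕ) {X A B : T} (a : A ⟶ B) (x : Fin (p + q + 1 + 1) → (X ⟶ A))
    (t : Fin (p + q + 1) → I), t ⟨p, by omega⟩ = 1 →
      cube (p + q + 1) a x t =
        cube p a (fun i => x ⟨i, by omega⟩) (fun i => t ⟨i, by omega⟩) +
        cube q a (fun i => x ⟨p + 1 + i, by omega⟩) (fun i => t ⟨p + 1 + i, by omega⟩)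
  /-- Continuity of `T(A, B) × T(X, A)^{n+1} → T(X, B)^{I^n}`, with the source a product of
  compactly generated spaces. -/
  continuous_cube : ∀ (n : ℕ) (X A B : T),
    CGContinuous fun q : (A ⟶ B) × (Fin (n + 1) → (X ⟶ A)) => cube n q.1 q.2

namespace InftyDistributor

variable {T : Type u} [Category.{v} T] [LeftLinearTopCategory T] (φ : InftyDistributor T)

/-- Universality in dimension `n`: `φ_a^{x_0, …, x_n} = φ_a^{p_0, …, p_n} ⊗ (x_0, …, x_n)`, where
the `p_i : A^{n+1} → A` are the projections; `f` is the map `(x_0, …, x_n) : X → A^{n+1}`. -/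
def IsUniversal (n : ℕ) : Prop :=
  ∀ {X A B P : T} (p : Fin (n + 1) → (P ⟶ A)), IsEnrichedProduct (fun _ => A) P p →
    ∀ (a : A ⟶ B) (x : Fin (n + 1) → (X ⟶ A)) (f : X ⟶ P), (∀ i, f ≫ p i = x i) →
      ∀ t, φ.cube n a x t = f ≫ φ.cube n a p t

/-- The wedge condition in dimension `n`: `φ_a^{0, …, x, …, 0}` is the constant cube at `a x`. -/
def SatisfiesWedge (n : ℕ) : Prop :=
  ∀ {X A B : T} (a : A ⟶ B) (x : X ⟶ A) (k : Fin (n + 1)) (t : Fin n → I),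
    φ.cube n a (Pi.single k x) t = x ≫ a

/-- A good `∞`-distributor. -/
def IsGood : Prop :=
  ∀ n, φ.IsUniversal n ∧ φ.SatisfiesWedge n

end InftyDistributor

/-!
The cubes of a good `∞`-distributor are constructed by induction on their dimension `n`. By
universality it suffices to construct, for all objects `A` and `B`, the universal cubes
`φ_a^{p_0, …, p_n}`, that is, a map `T(A, B) × I^n → T(A^{n+1}, B)`. The boundary conditions
prescribe this map on `T(A, B) × ∂I^n` in terms of cubes of lower dimension, and the wedge condition
prescribes its composite with the restriction `T(A^{n+1}, B) → T(A, B)^{n+1}` to the factors. The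
prescribed values on the faces of `I^n` are consistent, because addition is associative and
composition is left linear (`faceZero_eq_faceZero`, `faceZero_eq_faceOne`, `faceOne_eq_faceZero`,
`faceOne_eq_faceOne`), and they satisfy the wedge condition (`faceZero_single`, `faceOne_single`).
So the map to be constructed is the solution of a lifting problem for the inclusion of
`T(A, B) × ∂I^n` into `T(A, B) × I^n` (`exists_isGoodAt_update`).

The restriction to the factors is a composite of maps which weak bilinearity makes trivial Serre
fibrations (`IsWeaklyBilinearMappingTheory.liftsCubes_restrictionToFactors`). To solve the lifting
problem with `L = T(A, B)` Serre cofibrant, one needs that for a trivial Serre fibration `E → B` the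
map `E^{I^n} → E^{∂I^n} ×_{B^{∂I^n}} B^{I^n}` is again one, so that `L` lifts along it
(`IsSerreCofibrant.exists_lift`). This follows once trivial Serre fibrations are known to be the maps
with the right lifting property for the boundary inclusions of cubes, since a product of cubes is a
cube (`LiftsCubes.toPullbackHom`).

That characterisation (`IsTrivialSerreFibration.liftsCubes`,
`LiftsCubes.isTrivialSerreFibration`) is proved by filling open boxes. A Serre fibration lifts
against the inclusion of an open box (`IsSerreFibration.liftsRel_openBox`), because every point of
the cube is reached by a curve that starts on the open box and depends continuously on the point. By
means of such lifts, a lifting problem for a cube and its boundary is deformed to one for a sphere in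
a fibre, and this is solved by injectivity on `π_n` and surjectivity on `π_{n+1}`
(`IsTrivialSerreFibration.exists_nullhomotopy`).

Compactly generated products enter only through the continuity of composition, addition and
morphisms into products; there, continuity is tested on compact Hausdorff spaces, and the product of
such a space with a cube or its boundary is again compact Hausdorff.
-/

/-! ### Relative lifting -/

/-- The right lifting property of `p` with respect to the inclusion of `A` into `X`. A map on `A` is
encoded as a function on all of `X` that is continuous on `A`; its values off `A` are irrelevant. -/
def LiftsRel {X E B : Type*} [TopologicalSpace X] [TopologicalSpace E] [TopologicalSpace B]
    (A : Set X) (p : E → B) : Prop :=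
  ∀ (f : X → E) (H : X → B), ContinuousOn f A → Continuous H → (∀ a ∈ A, p (f a) = H a) →
    ∃ G : X → E, Continuous G ∧ (∀ a ∈ A, G a = f a) ∧ ∀ x, p (G x) = H x

theorem LiftsRel.of_retract {X Y E B : Type*} [TopologicalSpace X] [TopologicalSpace Y]
    [TopologicalSpace E] [TopologicalSpace B] {A : Set X} {A' : Set Y} {p : E → B}
    (h : LiftsRel A' p) (i : X → Y) (r : Y → X) (hi : Continuous i) (hr : Continuous r)
    (hri : ∀ x, r (i x) = x) (hiA : ∀ x ∈ A, i x ∈ A') (hrA : ∀ y ∈ A', r y ∈ A) :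
    LiftsRel A p := by
  intro f H hf hH hfH
  obtain ⟨G, hG, hGf, hGH⟩ := h (f ∘ r) (H ∘ r) (hf.comp hr.continuousOn hrA) (hH.comp hr)
    fun a ha => hfH _ (hrA a ha)
  exact ⟨G ∘ i, hG.comp hi, fun a ha => by simp [hGf _ (hiA a ha), hri],
    fun x => by simp [hGH, hri]⟩

theorem LiftsRel.of_homeomorph {X Y E B : Type*} [TopologicalSpace X] [TopologicalSpace Y]
    [TopologicalSpace E] [TopologicalSpace B] {A : Set X} {A' : Set Y} {p : E → B}
    (h : LiftsRel A' p) (e : X ≃ₜ Y) (he : ∀ x, x ∈ A ↔ e x ∈ A') : LiftsRel A p :=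
  h.of_retract e e.symm e.continuous e.symm.continuous e.symm_apply_apply
    (fun x hx => (he x).1 hx) fun y hy => (he _).2 (by simpa using hy)

/-- Two continuous partial functions on closed sets that agree on the overlap have a common
continuous extension to the union. -/
theorem exists_glue {X Y : Type*} [TopologicalSpace X] [TopologicalSpace Y] {A A' : Set X}
    (hA : IsClosed A) (hA' : IsClosed A') {f g : X → Y} (hf : ContinuousOn f A)
    (hg : ContinuousOn g A') (hfg : ∀ x ∈ A, x ∈ A' → f x = g x) :
    ∃ h : X → Y, ContinuousOn h (A ∪ A') ∧ (∀ x ∈ A, h x = f x) ∧ ∀ x ∈ A', h x = g x := by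
  classical
  have h1 : ∀ x ∈ A, A.piecewise f g x = f x := fun x hx => Set.piecewise_eq_of_mem _ _ _ hx
  have h2 : ∀ x ∈ A', A.piecewise f g x = g x := fun x hx => by
    by_cases hxA : x ∈ A
    · rw [h1 x hxA, hfg x hxA hx]
    · exact Set.piecewise_eq_of_notMem _ _ _ hxA
  exact ⟨A.piecewise f g, (hf.congr h1).union_of_isClosed (hg.congr h2) hA hA', h1, h2⟩

/-- `(Z, D)` is an `n`-cube together with its boundary, up to homeomorphism. -/
def IsCubePair {Z : Type*} [TopologicalSpace Z] (n : ℕ) (D : Set Z) : Prop :=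
  ∃ e : Z ≃ₜ (Fin n → I), ∀ z, z ∈ D ↔ e z ∈ Cube.boundary (Fin n)

theorem isCubePair_boundary (n : ℕ) : IsCubePair n (Cube.boundary (Fin n)) :=
  ⟨Homeomorph.refl _, fun _ => Iff.rfl⟩

theorem isCubePair_endpoints : IsCubePair 1 ({0, 1} : Set I) :=
  ⟨(Homeomorph.funUnique (Fin 1) I).symm, fun z => by
    simp [Cube.boundary]⟩

theorem IsCubePair.prod {Z W : Type*} [TopologicalSpace Z] [TopologicalSpace W] {D : Set Z}
    {D' : Set W} {n m : ℕ} (h : IsCubePair n D) (h' : IsCubePair m D') :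
    IsCubePair (n + m) {z : Z × W | z.1 ∈ D ∨ z.2 ∈ D'} := by
  obtain ⟨e, he⟩ := h
  obtain ⟨e', he'⟩ := h'
  refine ⟨(e.prodCongr e').trans (Fin.appendHomeomorph n m), fun z => ?_⟩
  simp only [Set.mem_ofPred_eq, he, he', Cube.boundary, Homeomorph.trans_apply]
  constructor
  · rintro (⟨i, hi⟩ | ⟨i, hi⟩)
    · exact ⟨Fin.castAdd m i, by simpa [Fin.appendHomeomorph] using hi⟩
    · exact ⟨Fin.natAdd n i, by simpa [Fin.appendHomeomorph] using hi⟩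
  · rintro ⟨i, hi⟩
    induction i using Fin.addCases with
    | left i => exact Or.inl ⟨i, by simpa [Fin.appendHomeomorph] using hi⟩
    | right i => exact Or.inr ⟨i, by simpa [Fin.appendHomeomorph] using hi⟩

theorem isClosed_cubeBoundary (n : ℕ) : IsClosed (Cube.boundary (Fin n)) := by
  have : Cube.boundary (Fin n) = ⋃ i, {y : Fin n → I | y i = 0 ∨ y i = 1} := by
    ext y; simp [Cube.boundary]
  rw [this]
  exact isClosed_iUnion_of_finite fun i =>
    (isClosed_eq (continuous_apply i) continuous_const).union
      (isClosed_eq (continuous_apply i) continuous_const)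

/-- `D × I` together with the bottom `Z × {0}`. For a cube and its boundary, this is the boundary
of a cube with one face missing. -/
def openBox {Z : Type*} (D : Set Z) : Set (Z × I) := {z | z.1 ∈ D ∨ z.2 = 0}

/-- `D × I` together with the top `Z × {1}`. -/
def openBoxTop {Z : Type*} (D : Set Z) : Set (Z × I) := {z | z.1 ∈ D ∨ z.2 = 1}

theorem LiftsRel.openBoxTop {Z E B : Type*} [TopologicalSpace Z] [TopologicalSpace E]
    [TopologicalSpace B] {D : Set Z} {p : E → B} (h : LiftsRel (openBox D) p) :
    LiftsRel (openBoxTop D) p :=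
  h.of_homeomorph ((Homeomorph.refl Z).prodCongr unitInterval.symmHomeomorph) fun z => by
    simp [_root_.openBox, _root_.openBoxTop, unitInterval.symm_eq_zero]

theorem isClosed_openBox {Z : Type*} [TopologicalSpace Z] {D : Set Z} (h : IsClosed D) :
    IsClosed (openBox D) :=
  (h.preimage continuous_fst).union (isClosed_eq continuous_snd continuous_const)

/-- The distance from the centre of the cube, in the maximum norm, normalised to be `1` on the
boundary. -/
noncomputable def cubeNorm {n : ℕ} (s : Fin n → I) : ℝ := ‖fun i => 2 * (s i : ℝ) - 1‖

theorem continuous_cubeNorm {n : ℕ} : Continuous (cubeNorm (n := n)) := by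
  unfold cubeNorm; fun_prop

theorem cubeNorm_le_one {n : ℕ} (s : Fin n → I) : cubeNorm s ≤ 1 := by
  refine (pi_norm_le_iff_of_nonneg zero_le_one).2 fun i => ?_
  rw [Real.norm_eq_abs, abs_le]
  constructor <;> linarith [(s i).2.1, (s i).2.2]

theorem cubeNorm_eq_one {n : ℕ} {s : Fin n → I} (hs : s ∈ Cube.boundary (Fin n)) :
    cubeNorm s = 1 := by
  refine le_antisymm (cubeNorm_le_one s) ?_
  obtain ⟨i, hi⟩ := hs
  refine le_trans ?_ (norm_le_pi_norm (fun i => 2 * (s i : ℝ) - 1) i)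
  rcases hi with hi | hi <;> norm_num [hi]

/-- The point of the unit interval closest to a real number. -/
noncomputable def clampI (x : ℝ) : I := Set.projIcc 0 1 zero_le_one x

theorem continuous_clampI : Continuous clampI :=
  continuous_projIcc (h := zero_le_one)

@[fun_prop]
theorem Continuous.clampI {X : Type*} [TopologicalSpace X] {f : X → ℝ} (hf : Continuous f) :
    Continuous fun x => clampI (f x) := continuous_clampI.comp hf

theorem clampI_coe (t : I) : clampI t = t := Set.projIcc_val _ t

theorem clampI_of_nonpos {x : ℝ} (h : x ≤ 0) : clampI x = 0 := Set.projIcc_of_le_left _ h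

theorem clampI_of_one_le {x : ℝ} (h : 1 ≤ x) : clampI x = 1 := Set.projIcc_of_right_le _ h

/-- Serre fibrations have the right lifting property for open boxes in cubes. The homotopy lifting
property for `I^n × I` lifts, for all points `x` at once, a curve from the open box to `x`; the lift
at `x` is the endpoint of the lifted curve. -/
theorem IsSerreFibration.liftsRel_openBox {E B : Type v} [TopologicalSpace E] [TopologicalSpace B]
    {p : C(E, B)} (hp : IsSerreFibration p) (n : ℕ) :
    LiftsRel (openBox (Cube.boundary (Fin n))) p := by
  -- The homotopy lifting property for `(I^n × I) × I`.
  have hlp : ∀ (f : (Fin n → I) × I → E) (H : ((Fin n → I) × I) × I → B), Continuous f →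
      Continuous H → (∀ x, p (f x) = H (x, 0)) → ∃ G : ((Fin n → I) × I) × I → E,
        Continuous G ∧ (∀ x, G (x, 0) = f x) ∧ ∀ z, p (G z) = H z := by
    intro f H hf hH hfH
    obtain ⟨e, -⟩ := (isCubePair_boundary n).prod isCubePair_endpoints
    obtain ⟨G, hG0, hG⟩ := hp (n + 1) ⟨fun z => H (e.symm z.1, z.2), by fun_prop⟩
      ⟨fun x => f (e.symm x), by fun_prop⟩ fun s => by simp [hfH]
    exact ⟨fun z => G (e z.1, z.2), by fun_prop, fun x => by simp [hG0], fun z => by simp [hG]⟩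
  -- The curve `τ ↦ D (x, τ)` starts on the open box and arrives at `x` at time `φr x`. Backwards in
  -- time, it moves away from the centre of `I^n` and towards the bottom.
  let φr : (Fin n → I) × I → ℝ := fun x => min (x.2 : ℝ) (2 * (1 - cubeNorm x.1))
  have hφc : Continuous φr := by
    have := continuous_cubeNorm (n := n)
    fun_prop
  have hφ0 : ∀ x, 0 ≤ φr x := fun x =>
    le_min x.2.2.1 (by linarith [cubeNorm_le_one x.1])
  have hφ1 : ∀ x, φr x ≤ 1 := fun x => (min_le_left _ _).trans x.2.2.2
  -- The time that is left until the curve arrives.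
  let u : ((Fin n → I) × I) × I → ℝ := fun z => max (φr z.1 - z.2) 0
  have hu : Continuous u := by fun_prop
  let D : ((Fin n → I) × I) × I → (Fin n → I) × I := fun z =>
    (fun i => clampI (((2 * (z.1.1 i : ℝ) - 1) * (1 + u z) + 1) / 2), clampI (z.1.2 - u z))
  have hD : Continuous D := by fun_prop
  have hDφ : ∀ x, D (x, clampI (φr x)) = x := by
    intro x
    have : clampI (φr x) = ⟨φr x, hφ0 x, hφ1 x⟩ := clampI_coe ⟨φr x, hφ0 x, hφ1 x⟩
    have hux : u (x, clampI (φr x)) = 0 := by simp [u, this]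
    refine Prod.ext (funext fun i => ?_) ?_
    · simp only [D, hux]
      rw [show ((2 * (x.1 i : ℝ) - 1) * (1 + 0) + 1) / 2 = x.1 i by ring, clampI_coe]
    · simp only [D, hux]
      rw [sub_zero, clampI_coe]
  have hD0 : ∀ x, D (x, 0) ∈ openBox (Cube.boundary (Fin n)) := by
    intro x
    have hux : u (x, 0) = φr x := by simp [u, hφ0 x]
    by_cases hx : (x.2 : ℝ) ≤ 2 * (1 - cubeNorm x.1)
    · right
      simp only [D, hux]
      exact clampI_of_nonpos (by simp [φr, hx])
    · left
      have hφx : φr x = 2 * (1 - cubeNorm x.1) := min_eq_right (not_le.1 hx).le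
      have hm : 1 / 2 < cubeNorm x.1 := by linarith [x.2.2.2, not_le.1 hx]
      by_contra hb
      -- Otherwise all coordinates stay in the open interval, so that the norm is too small.
      have hlt : ∀ i, ‖2 * (x.1 i : ℝ) - 1‖ < 1 / (1 + φr x) := by
        intro i
        have hpos : 0 < 1 + φr x := by linarith [hφ0 x]
        rw [lt_div_iff₀ hpos, Real.norm_eq_abs]
        by_contra hge
        apply hb
        refine ⟨i, ?_⟩
        simp only [D, hux]
        rcases le_total 0 (2 * (x.1 i : ℝ) - 1) with h0 | h0
        · right
          rw [abs_of_nonneg h0] at hge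
          exact clampI_of_one_le (by linarith)
        · left
          rw [abs_of_nonpos h0] at hge
          exact clampI_of_nonpos (by linarith)
      have hpos : 0 < 1 + φr x := by linarith [hφ0 x]
      have := (pi_norm_lt_iff (by positivity)).2 hlt
      change cubeNorm x.1 < _ at this
      rw [lt_div_iff₀ hpos, hφx] at this
      nlinarith [cubeNorm_le_one x.1]
  have hφJ : ∀ x ∈ openBox (Cube.boundary (Fin n)), clampI (φr x) = 0 := by
    intro x hx
    refine clampI_of_nonpos ?_
    rcases hx with hx | hx
    · exact (min_le_right _ _).trans (by rw [cubeNorm_eq_one hx]; simp)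
    · exact (min_le_left _ _).trans (by simp [hx])
  intro f H hf hH hfH
  obtain ⟨G, hG, hG0, hGH⟩ := hlp (fun x => f (D (x, 0))) (fun z => H (D z))
    (hf.comp_continuous (by fun_prop) hD0) (by fun_prop) fun x => hfH _ (hD0 x)
  refine ⟨fun x => G (x, clampI (φr x)), by fun_prop, fun a ha => ?_, fun x => ?_⟩
  · have h0 := hDφ a
    simp only [hφJ a ha] at h0 ⊢
    rw [hG0, h0]
  · rw [hGH, hDφ]

theorem LiftsRel.openBox_of_isCubePair {Z E B : Type*} [TopologicalSpace Z] [TopologicalSpace E]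
    [TopologicalSpace B] {D : Set Z} {p : E → B}
    (h : ∀ n, LiftsRel (openBox (Cube.boundary (Fin n))) p) {n : ℕ} (hD : IsCubePair n D) :
    LiftsRel (openBox D) p := by
  obtain ⟨e, he⟩ := hD
  exact (h n).of_homeomorph (e.prodCongr (Homeomorph.refl I)) fun z => by
    simp [_root_.openBox, he]

/-! ### Trivial Serre fibrations lift against boundary inclusions of cubes -/

/-- The right lifting property with respect to the inclusions of the boundaries of all cubes.
Surjectivity is the case of the `0`-cube; it is required separately because `LiftsRel ∅ p` holds
trivially if the source of `p` is empty. -/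
def LiftsCubes {E B : Type*} [TopologicalSpace E] [TopologicalSpace B] (p : E → B) : Prop :=
  Function.Surjective p ∧ ∀ n : ℕ, LiftsRel (Cube.boundary (Fin n)) p

theorem LiftsCubes.liftsRel {Z E B : Type*} [TopologicalSpace Z] [TopologicalSpace E]
    [TopologicalSpace B] {D : Set Z} {p : E → B} (h : LiftsCubes p) {n : ℕ}
    (hD : IsCubePair n D) : LiftsRel D p := by
  obtain ⟨e, he⟩ := hD
  exact (h.2 n).of_homeomorph e he

/-- Surjectivity on `π_n`, in terms of representatives defined on an arbitrary `n`-cube. -/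
theorem IsWeakHomotopyEquiv.exists_homotopy {E B : Type v} [TopologicalSpace E]
    [TopologicalSpace B] {p : C(E, B)} (hp : IsWeakHomotopyEquiv p) {Z : Type*}
    [TopologicalSpace Z] {D : Set Z} {n : ℕ} (hD : IsCubePair n D) (e : E) (γ : Z → B)
    (hγ : Continuous γ) (hγD : ∀ z ∈ D, γ z = p e) :
    ∃ (β : Z → E) (K : Z × I → B), Continuous β ∧ Continuous K ∧ (∀ z ∈ D, β z = e) ∧
      (∀ z, K (z, 0) = p (β z)) ∧ (∀ z, K (z, 1) = γ z) ∧ ∀ z ∈ D, ∀ t, K (z, t) = p e := by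
  obtain ⟨h, hh⟩ := hD
  obtain ⟨b, hb⟩ := (hp.2 n e).2 (Quotient.mk _ (⟨⟨fun s => γ (h.symm s), by fun_prop⟩,
    fun s hs => hγD _ ((hh _).2 (by simpa using hs))⟩ : GenLoop (Fin n) B (p e)))
  induction b using Quotient.inductionOn with
  | h b =>
    obtain ⟨F⟩ := Quotient.exact hb
    have hK : ∀ z ∈ D, ∀ t, F (t, h z) = p e := fun z hz t => by
      rw [F.eq_fst t ((hh z).1 hz)]
      exact congrArg p (b.2 _ ((hh z).1 hz))
    refine ⟨fun z => b.1 (h z), fun z => F (z.2, h z.1), by fun_prop, by fun_prop,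
      fun z hz => b.2 _ ((hh z).1 hz), fun z => ?_, fun z => ?_, hK⟩
    · simp only [F.apply_zero]; rfl
    · simp only [F.apply_one]
      simp

/-- Injectivity on `π_n`, for a sphere that lies in a fibre. -/
theorem IsWeakHomotopyEquiv.exists_nullhomotopy {E B : Type v} [TopologicalSpace E]
    [TopologicalSpace B] {p : C(E, B)} (hp : IsWeakHomotopyEquiv p) {n : ℕ} (e : E)
    (α : (Fin n → I) → E) (hα : Continuous α) (hαD : ∀ s ∈ Cube.boundary (Fin n), α s = e)
    (hpα : ∀ s, p (α s) = p e) :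
    ∃ A : (Fin n → I) × I → E, Continuous A ∧ (∀ s, A (s, 0) = e) ∧ (∀ s, A (s, 1) = α s) ∧
      ∀ s ∈ Cube.boundary (Fin n), ∀ t, A (s, t) = e := by
  have heq : (Quotient.mk _ (⟨⟨fun _ => e, continuous_const⟩, fun _ _ => rfl⟩ :
      GenLoop (Fin n) E e) : HomotopyGroup.Pi n E e) =
      Quotient.mk _ (⟨⟨α, hα⟩, hαD⟩ : GenLoop (Fin n) E e) := by
    apply (hp.2 n e).1
    refine congrArg (Quotient.mk _) (Subtype.ext (ContinuousMap.ext fun s => ?_))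
    exact (hpα s).symm
  obtain ⟨F⟩ := Quotient.exact heq
  refine ⟨fun z => F (z.2, z.1), by fun_prop, fun s => by simp only [F.apply_zero]; rfl,
    fun s => by simp only [F.apply_one]; rfl, fun s hs t => ?_⟩
  exact F.eq_fst t hs

/-- A sphere in a fibre of a trivial Serre fibration bounds a disc in that fibre. The null-homotopy
in the total space that is given by injectivity on `π_n` is corrected by an element of `π_{n+1}` of
the total space; the correction is made by filling an open box. -/
theorem IsTrivialSerreFibration.exists_nullhomotopy {E B : Type v} [TopologicalSpace E]
    [TopologicalSpace B] {p : C(E, B)} (hp : IsTrivialSerreFibration p) {n : ℕ} (e : E)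
    (α : (Fin n → I) → E) (hα : Continuous α) (hαD : ∀ s ∈ Cube.boundary (Fin n), α s = e)
    (hpα : ∀ s, p (α s) = p e) :
    ∃ A : (Fin n → I) × I → E, Continuous A ∧ (∀ z ∈ openBox (Cube.boundary (Fin n)), A z = e) ∧
      (∀ s, A (s, 1) = α s) ∧ ∀ z, p (A z) = p e := by
  obtain ⟨A₀, hA₀, hA₀0, hA₀1, hA₀D⟩ := hp.2.exists_nullhomotopy e α hα hαD hpα
  have hC := (isCubePair_boundary n).prod isCubePair_endpoints
  obtain ⟨β, K, hβ, hK, hβD, hK0, hK1, hKD⟩ :=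
    hp.2.exists_homotopy hC e (fun z => p (A₀ z)) (by fun_prop) (by
      rintro ⟨s, t⟩ (h | h | h)
      · exact congrArg p (hA₀D s h t)
      · obtain rfl : t = 0 := h
        exact congrArg p (hA₀0 s)
      · obtain rfl : t = 1 := h
        simp only [hA₀1, hpα])
  have hBc := isClosed_cubeBoundary n
  -- The coordinates are `((s, τ), t)`, where `τ` is the coordinate of the homotopy `K`.
  obtain ⟨f₁, hf₁, hf₁e, hf₁β⟩ := exists_glue (X := ((Fin n → I) × I) × I)
    (A := {z | z.1.1 ∈ Cube.boundary (Fin n) ∨ z.2 = 0}) (A' := {z | z.1.2 = 0})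
    ((hBc.preimage (by fun_prop)).union (isClosed_eq (by fun_prop) (by fun_prop)))
    (isClosed_eq (by fun_prop) (by fun_prop)) (f := fun _ => e) (g := fun z => β (z.1.1, z.2))
    continuousOn_const (by fun_prop) (by
      rintro ⟨⟨s, τ⟩, t⟩ (h | h) -
      · exact (hβD (s, t) (Or.inl h)).symm
      · exact (hβD (s, t) (Or.inr (Or.inl h))).symm)
  obtain ⟨f, hf, hff, hfA⟩ := exists_glue (A' := {z : ((Fin n → I) × I) × I | z.1.2 = 1})
    (((hBc.preimage (by fun_prop)).union (isClosed_eq (by fun_prop) (by fun_prop))).union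
      (isClosed_eq (by fun_prop) (by fun_prop)))
    (isClosed_eq (by fun_prop) (by fun_prop)) (g := fun z => A₀ (z.1.1, z.2)) hf₁ (by fun_prop) (by
      rintro ⟨⟨s, τ⟩, t⟩ (h | h) h'
      · rw [hf₁e _ h]
        rcases h with h | h
        · exact (hA₀D s h t).symm
        · obtain rfl : t = 0 := h
          exact (hA₀0 s).symm
      · exact absurd (h.symm.trans h') zero_ne_one)
  obtain ⟨G, hG, hGf, hGK⟩ := LiftsRel.openBox_of_isCubePair hp.1.liftsRel_openBox hC f
    (fun z => K ((z.1.1, z.2), z.1.2)) (hf.mono (by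
      rintro ⟨⟨s, τ⟩, t⟩ ((h | h | h) | h)
      · exact Or.inl (Or.inl (Or.inl h))
      · exact Or.inl (Or.inr h)
      · exact Or.inr h
      · exact Or.inl (Or.inl (Or.inr h)))) (by fun_prop) (by
      rintro ⟨⟨s, τ⟩, t⟩ ((h | h | h) | h)
      · rw [hff _ (Or.inl (Or.inl h)), hf₁e _ (Or.inl h)]
        exact (hKD (s, t) (Or.inl h) τ).symm
      · rw [hff _ (Or.inr h), hf₁β _ h]
        obtain rfl : τ = 0 := h
        exact (hK0 _).symm
      · rw [hfA _ h]
        obtain rfl : τ = 1 := h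
        exact (hK1 _).symm
      · rw [hff _ (Or.inl (Or.inr h)), hf₁e _ (Or.inr h)]
        exact (hKD (s, t) (Or.inr (Or.inl h)) τ).symm)
  -- The missing face `t = 1` is the corrected null-homotopy.
  refine ⟨fun z => G (z, 1), by fun_prop, ?_, fun s => ?_, fun z => ?_⟩
  · rintro ⟨s, τ⟩ (h | h)
    · change G ((s, τ), 1) = e
      rw [hGf _ (Or.inl (Or.inl h)), hff _ (Or.inl (Or.inl h)), hf₁e _ (Or.inl h)]
    · change G ((s, τ), 1) = e
      rw [hGf _ (Or.inl (Or.inr (Or.inl h))), hff _ (Or.inr h), hf₁β _ h]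
      exact hβD (s, 1) (Or.inr (Or.inr rfl))
  · change G ((s, 1), 1) = α s
    rw [hGf ((s, 1), 1) (Or.inl (Or.inr (Or.inr rfl))), hfA _ rfl]
    exact hA₀1 s
  · change p (G (z, 1)) = p e
    rw [hGK]
    exact hKD (z.1, 1) (Or.inr (Or.inr rfl)) z.2

theorem IsTrivialSerreFibration.surjective {E B : Type v} [TopologicalSpace E]
    [TopologicalSpace B] {p : C(E, B)} (hp : IsTrivialSerreFibration p) (b : B) :
    ∃ e, p e = b := by
  obtain ⟨e⟩ := hp.2.1 ⟨b⟩
  have hno : ∀ s, s ∉ Cube.boundary (Fin 0) := fun s ⟨i, _⟩ => i.elim0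
  obtain ⟨β, K, hβ, hK, -, hK0, hK1, -⟩ := hp.2.exists_homotopy (isCubePair_boundary 0) e
    (fun _ => b) continuous_const fun s hs => absurd hs (hno s)
  obtain ⟨G, -, hG⟩ := hp.1 0 ⟨K, hK⟩ ⟨β, hβ⟩ fun s => (hK0 s).symm
  exact ⟨G (0, 1), (hG _).trans (hK1 _)⟩

/-- The scaling of `I^n × I` by `τ`, centred at the vertex `0`. -/
def scaleCube {n : ℕ} (τ : I) (y : (Fin n → I) × I) : (Fin n → I) × I :=
  (fun i => τ * y.1 i, τ * y.2)

@[fun_prop]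
theorem Continuous.scaleCube {X : Type*} [TopologicalSpace X] {n : ℕ} {f : X → I}
    {g : X → (Fin n → I) × I} (hf : Continuous f) (hg : Continuous g) :
    Continuous fun x => scaleCube (f x) (g x) := by
  unfold _root_.scaleCube; fun_prop

theorem scaleCube_one {n : ℕ} (y : (Fin n → I) × I) : scaleCube 1 y = y := by
  simp [scaleCube]

theorem scaleCube_zero {n : ℕ} (y : (Fin n → I) × I) : scaleCube 0 y = 0 := by
  simp [scaleCube]; rfl

/-- Given a lifting problem on `I^n × I`, a lift `g` for the open box without the top is found
first, and the scaling of the cube together with `g` deforms the problem to one that is constant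
except on the top face. -/
theorem IsTrivialSerreFibration.liftsCubes {E B : Type v} [TopologicalSpace E]
    [TopologicalSpace B] {p : C(E, B)} (hp : IsTrivialSerreFibration p) : LiftsCubes p := by
  refine ⟨hp.surjective, ?_⟩
  rintro (_ | n)
  · intro f H hf hH hfH
    obtain ⟨e, he⟩ := hp.surjective (H 0)
    exact ⟨fun _ => e, continuous_const, fun a ⟨i, _⟩ => i.elim0,
      fun x => he.trans (congrArg H (Subsingleton.elim _ _))⟩
  obtain ⟨h, hh⟩ := (isCubePair_boundary n).prod isCubePair_endpoints
  suffices LiftsRel {z : (Fin n → I) × I | z.1 ∈ Cube.boundary (Fin n) ∨ z.2 ∈ ({0, 1} : Set I)} p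
    from this.of_homeomorph h.symm fun z => ((hh (h.symm z)).trans (by simp)).symm
  intro f H hf hH hfH
  have hBc := isClosed_cubeBoundary n
  have hbox := hp.1.liftsRel_openBox
  have hJ : ∀ z ∈ openBox (Cube.boundary (Fin n)),
      z.1 ∈ Cube.boundary (Fin n) ∨ z.2 ∈ ({0, 1} : Set I) := fun z hz => hz.imp_right Or.inl
  obtain ⟨g, hg, hgf, hgH⟩ := hbox n f H (hf.mono hJ) hH fun a ha => hfH a (hJ a ha)
  -- The deformation of the top face, from `f` at time `1` to a map that is constant on the boundary
  -- at time `0`. On the boundary it is given by `g`.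
  obtain ⟨k, hk, hkg, hkf⟩ := exists_glue (X := (Fin n → I) × I)
    (A := {z | z.1 ∈ Cube.boundary (Fin n)}) (A' := {z | z.2 = 1})
    (hBc.preimage (by fun_prop)) (isClosed_eq (by fun_prop) (by fun_prop))
    (f := fun z => g (scaleCube z.2 (z.1, 1))) (g := fun z => f (z.1, 1)) (by fun_prop)
    (hf.comp (Continuous.continuousOn (by fun_prop)) fun z _ => Or.inr (Or.inr rfl)) (by
      intro z hz hz'
      obtain hz' : z.2 = 1 := hz'
      simp only [hz', scaleCube_one]
      exact hgf _ (Or.inl hz))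
  obtain ⟨N, hN, hNk, hNH⟩ := (hbox n).openBoxTop k (fun z => H (scaleCube z.2 (z.1, 1))) hk
    (by fun_prop) (by
      rintro z (hz | hz)
      · rw [hkg z hz, hgH]
      · rw [hkf z hz, hz, scaleCube_one]
        exact hfH _ (Or.inr (Or.inr rfl)))
  have hNg : ∀ s ∈ Cube.boundary (Fin n), ∀ τ, N (s, τ) = g (scaleCube τ (s, 1)) :=
    fun s hs τ => (hNk _ (Or.inl hs)).trans (hkg _ hs)
  have hNf : ∀ s, N (s, 1) = f (s, 1) := fun s => (hNk _ (Or.inr rfl)).trans (hkf _ rfl)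
  -- `A` solves the problem at time `0`.
  obtain ⟨A, hA, hAJ, hA1, hpA⟩ := hp.exists_nullhomotopy (g 0) (fun s => N (s, 0)) (by fun_prop)
    (fun s hs => by simp only [hNg s hs, scaleCube_zero])
    fun s => by simp only [hNH, hgH, scaleCube_zero]
  -- The deformation is lifted to the whole cube, starting with `A`; at time `1` this is the solution
  -- of the original problem.
  obtain ⟨k₁, hk₁, hk₁g, hk₁N⟩ := exists_glue (X := ((Fin n → I) × I) × I)
    (A := {z | z.1 ∈ openBox (Cube.boundary (Fin n))}) (A' := {z | z.1.2 = 1})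
    ((isClosed_openBox hBc).preimage continuous_fst) (isClosed_eq (by fun_prop) (by fun_prop))
    (f := fun z => g (scaleCube z.2 z.1)) (g := fun z => N (z.1.1, z.2)) (by fun_prop)
    (by fun_prop) (by
      rintro ⟨⟨s, t⟩, τ⟩ (h | h) h'
      · obtain rfl : t = 1 := h'
        exact (hNg s h τ).symm
      · exact absurd (h.symm.trans h') zero_ne_one)
  obtain ⟨k₂, hk₂, hk₂k, hk₂A⟩ := exists_glue (A' := {z : ((Fin n → I) × I) × I | z.2 = 0})
    (((isClosed_openBox hBc).preimage continuous_fst).union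
      (isClosed_eq (by fun_prop) (by fun_prop)))
    (isClosed_eq (by fun_prop) (by fun_prop)) (g := fun z => A z.1) hk₁ (by fun_prop) (by
      rintro ⟨y, τ⟩ h h'
      obtain rfl : τ = 0 := h'
      rcases h with h | h
      · rw [hk₁g _ h, scaleCube_zero]
        exact (hAJ y h).symm
      · rw [hk₁N _ h]
        obtain ⟨s, t⟩ := y
        obtain rfl : t = 1 := h
        exact (hA1 s).symm)
  have hsub : ∀ y : (Fin n → I) × I, y.1 ∈ Cube.boundary (Fin n) ∨ y.2 ∈ ({0, 1} : Set I) →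
      y ∈ openBox (Cube.boundary (Fin n)) ∨ y.2 = 1 := by
    rintro y (h | h | h)
    exacts [Or.inl (Or.inl h), Or.inl (Or.inr h), Or.inr h]
  obtain ⟨G, hG, hGk, hGH⟩ := LiftsRel.openBox_of_isCubePair hbox
    ((isCubePair_boundary n).prod isCubePair_endpoints) k₂ (fun z => H (scaleCube z.2 z.1))
    (hk₂.mono (by
      rintro ⟨y, τ⟩ (h | h)
      · exact Or.inl (hsub y h)
      · exact Or.inr h)) (by fun_prop) (by
      rintro ⟨y, τ⟩ (h | h)
      · rw [hk₂k _ (hsub y h)]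
        rcases hsub y h with h | h
        · rw [hk₁g _ h, hgH]
        · rw [hk₁N _ h, hNH]
          obtain ⟨s, t⟩ := y
          obtain rfl : t = 1 := h
          rfl
      · rw [hk₂A _ h, hpA, hgH]
        obtain rfl : τ = 0 := h
        simp only [scaleCube_zero])
  refine ⟨fun y => G (y, 1), by fun_prop, fun y hy => ?_, fun y => ?_⟩
  · change G (y, 1) = f y
    rw [hGk _ (Or.inl hy), hk₂k _ (hsub y hy)]
    rcases hsub y hy with h | h
    · rw [hk₁g _ h, scaleCube_one, hgf y h]
    · rw [hk₁N _ h, hNf]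
      obtain ⟨s, t⟩ := y
      obtain rfl : t = 1 := h
      rfl
  · change p (G (y, 1)) = H y
    rw [hGH, scaleCube_one]

/-! ### Maps that lift against boundary inclusions of cubes -/

theorem LiftsCubes.liftsRel_openBox {E B : Type*} [TopologicalSpace E] [TopologicalSpace B]
    {p : E → B} (hp : LiftsCubes p) (n : ℕ) : LiftsRel (openBox (Cube.boundary (Fin n))) p := by
  intro f H hf hH hfH
  have hBc := isClosed_cubeBoundary n
  -- The lift is extended over the top face first.
  obtain ⟨g, hg, hgf, hgH⟩ := hp.2 n (fun s => f (s, 1)) (fun s => H (s, 1))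
    (hf.comp (Continuous.continuousOn (by fun_prop)) fun s hs => Or.inl hs) (by fun_prop)
    fun s hs => hfH _ (Or.inl hs)
  obtain ⟨k, hk, hkf, hkg⟩ := exists_glue (A' := {z : (Fin n → I) × I | z.2 = 1})
    (isClosed_openBox hBc) (isClosed_eq (by fun_prop) (by fun_prop)) (g := fun z => g z.1) hf
    (by fun_prop) (by
      rintro ⟨s, t⟩ h h'
      obtain rfl : t = 1 := h'
      rcases h with h | h
      · exact (hgf s h).symm
      · exact absurd h one_ne_zero)
  obtain ⟨G, hG, hGk, hGH⟩ := hp.liftsRel ((isCubePair_boundary n).prod isCubePair_endpoints) k H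
    (hk.mono (by
      rintro z (h | h | h)
      exacts [Or.inl (Or.inl h), Or.inl (Or.inr h), Or.inr h])) hH (by
      rintro ⟨s, t⟩ (h | h | h)
      · rw [hkf _ (Or.inl h), hfH _ (Or.inl h)]
      · rw [hkf _ (Or.inr h), hfH _ (Or.inr h)]
      · rw [hkg _ h]
        obtain rfl : t = 1 := h
        exact hgH s)
  refine ⟨G, hG, fun z hz => ?_, hGH⟩
  rw [hGk z (hz.imp_right Or.inl), hkf z hz]

/-- The inclusion of `I^n × {0}` is a retract of the inclusion of an open box. -/
theorem LiftsCubes.liftsRel_bottom {E B : Type*} [TopologicalSpace E] [TopologicalSpace B]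
    {p : E → B} (hp : LiftsCubes p) (n : ℕ) :
    LiftsRel {z : (Fin n → I) × I | z.2 = 0} p := by
  have hc := continuous_cubeNorm (n := n)
  refine (hp.liftsRel_openBox n).of_retract
    (fun z => (fun i => clampI ((z.1 i : ℝ) / 2 + 1 / 4), z.2))
    (fun z => (fun i => clampI (2 * (z.1 i : ℝ) - 1 / 2), z.2 * clampI (2 * (1 - cubeNorm z.1))))
    (by fun_prop) (by fun_prop) ?_ (fun z hz => Or.inr hz) ?_
  · rintro ⟨s, t⟩
    have hcl : ∀ i, (clampI ((s i : ℝ) / 2 + 1 / 4) : ℝ) = (s i : ℝ) / 2 + 1 / 4 := fun i =>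
      congrArg Subtype.val (clampI_coe
        ⟨(s i : ℝ) / 2 + 1 / 4, by linarith [(s i).2.1], by linarith [(s i).2.2]⟩)
    have hnorm : cubeNorm (fun i => clampI ((s i : ℝ) / 2 + 1 / 4)) ≤ 1 / 2 := by
      refine (pi_norm_le_iff_of_nonneg (by norm_num)).2 fun i => ?_
      rw [hcl, Real.norm_eq_abs, abs_le]
      constructor <;> linarith [(s i).2.1, (s i).2.2]
    refine Prod.ext (funext fun i => ?_) ?_
    · simp only [hcl]
      rw [show 2 * ((s i : ℝ) / 2 + 1 / 4) - 1 / 2 = s i by ring, clampI_coe]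
    · simp only
      rw [clampI_of_one_le (by linarith), mul_one]
  · rintro ⟨s, t⟩ (h | h)
    · simp only [Set.mem_ofPred_eq]
      rw [cubeNorm_eq_one h, clampI_of_nonpos (by norm_num), mul_zero]
    · obtain rfl : t = 0 := h
      simp

/-- The converse of `IsTrivialSerreFibration.liftsCubes`. -/
theorem LiftsCubes.isTrivialSerreFibration {E B : Type v} [TopologicalSpace E]
    [TopologicalSpace B] {p : C(E, B)} (hp : LiftsCubes p) : IsTrivialSerreFibration p := by
  refine ⟨fun n H f hfH => ?_, fun ⟨b⟩ => ?_, fun n x => ⟨?_, ?_⟩⟩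
  · obtain ⟨G, hG, hGf, hGH⟩ := hp.liftsRel_bottom n (fun z => f z.1) H (by fun_prop)
      H.continuous (by
        rintro ⟨s, t⟩ h
        obtain rfl : t = 0 := h
        exact hfH s)
    exact ⟨⟨G, hG⟩, fun s => hGf _ rfl, hGH⟩
  · exact (hp.1 b).nonempty
  · intro a b hab
    induction a, b using Quotient.inductionOn₂ with
    | h a b =>
      obtain ⟨F⟩ := Quotient.exact hab
      obtain ⟨k, hk, hka, hkb⟩ := exists_glue (X := (Fin n → I) × I)
        (A := openBox (Cube.boundary (Fin n))) (A' := {z | z.2 = 1})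
        (isClosed_openBox (isClosed_cubeBoundary n)) (isClosed_eq (by fun_prop) (by fun_prop))
        (f := fun z => a.1 z.1) (g := fun z => b.1 z.1) (by fun_prop) (by fun_prop) (by
          rintro ⟨s, t⟩ (h | h) h'
          · exact (a.2 s h).trans (b.2 s h).symm
          · exact absurd (h.symm.trans h') zero_ne_one)
      obtain ⟨G, hG, hGk, -⟩ := hp.liftsRel ((isCubePair_boundary n).prod isCubePair_endpoints) k
        (fun z => F (z.2, z.1)) (hk.mono (by
          rintro z (h | h | h)
          exacts [Or.inl (Or.inl h), Or.inl (Or.inr h), Or.inr h])) (by fun_prop) (by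
          rintro ⟨s, t⟩ (h | h | h)
          · rw [hka _ (Or.inl h)]
            exact (F.eq_fst t h).symm
          · rw [hka _ (Or.inr h)]
            obtain rfl : t = 0 := h
            exact (F.apply_zero s).symm
          · rw [hkb _ h]
            obtain rfl : t = 1 := h
            exact (F.apply_one s).symm)
      refine Quotient.sound ⟨⟨⟨⟨fun z => G (z.2, z.1), by fun_prop⟩, fun s => ?_, fun s => ?_⟩,
        fun t s hs => ?_⟩⟩
      · exact (hGk (s, 0) (Or.inr (Or.inl rfl))).trans (hka _ (Or.inr rfl))
      · exact (hGk (s, 1) (Or.inr (Or.inr rfl))).trans (hkb _ rfl)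
      · exact (hGk (s, t) (Or.inl hs)).trans (hka _ (Or.inl hs))
  · intro c
    induction c using Quotient.inductionOn with
    | h c =>
      obtain ⟨G, hG, hGx, hGc⟩ := hp.2 n (fun _ => x) c.1 continuousOn_const c.1.continuous
        fun s hs => (c.2 s hs).symm
      exact ⟨Quotient.mk _ ⟨⟨G, hG⟩, hGx⟩,
        congrArg (Quotient.mk _) (Subtype.ext (ContinuousMap.ext hGc))⟩

/-- Composites of maps that lift against cube boundaries. -/
theorem LiftsCubes.comp {E B C : Type*} [TopologicalSpace E] [TopologicalSpace B]
    [TopologicalSpace C] {p : E → B} {q : B → C} (hq : LiftsCubes q) (hp : LiftsCubes p)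
    (hpc : Continuous p) : LiftsCubes (q ∘ p) := by
  refine ⟨hq.1.comp hp.1, fun n f H hf hH hfH => ?_⟩
  obtain ⟨G, hG, hGf, hGH⟩ := hq.2 n (p ∘ f) H (hpc.comp_continuousOn hf) hH hfH
  obtain ⟨G', hG', hGf', hGH'⟩ := hp.2 n f G hf hG fun a ha => (hGf a ha).symm
  exact ⟨G', hG', hGf', fun x => (congrArg q (hGH' x)).trans (hGH x)⟩

theorem LiftsCubes.prodMap_id {E B C : Type*} [TopologicalSpace E] [TopologicalSpace B]
    [TopologicalSpace C] {p : E → B} (hp : LiftsCubes p) :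
    LiftsCubes (Prod.map p (id : C → C)) := by
  refine ⟨hp.1.prodMap Function.surjective_id, fun n f H hf hH hfH => ?_⟩
  obtain ⟨G, hG, hGf, hGH⟩ := hp.2 n (fun x => (f x).1) (fun x => (H x).1)
    (continuous_fst.comp_continuousOn hf) (by fun_prop) fun a ha => congrArg Prod.fst (hfH a ha)
  exact ⟨fun x => (G x, (H x).2), by fun_prop,
    fun a ha => Prod.ext (hGf a ha) (congrArg Prod.snd (hfH a ha)).symm,
    fun x => Prod.ext (hGH x) rfl⟩

theorem Homeomorph.liftsCubes {E B : Type*} [TopologicalSpace E] [TopologicalSpace B]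
    (e : E ≃ₜ B) : LiftsCubes e :=
  ⟨e.surjective, fun _ f H _ hH hfH => ⟨fun x => e.symm (H x), by fun_prop,
    fun a ha => by simp [← hfH a ha], fun x => by simp⟩⟩

/-! ### Pullback-homs and Serre cofibrant spaces -/

/-- The target of the map `C(X, E) → C(A, E) ×_{C(A, B)} C(X, B)`. -/
abbrev PullbackHom {X : Type} {E B : Type v} [TopologicalSpace X] [TopologicalSpace E]
    [TopologicalSpace B] (A : Set X) (p : C(E, B)) : Type v :=
  {w : C(A, E) × C(X, B) // p.comp w.1 = w.2.restrict A}

/-- The map `C(X, E) → C(A, E) ×_{C(A, B)} C(X, B)`. -/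
def toPullbackHom {X : Type} {E B : Type v} [TopologicalSpace X] [TopologicalSpace E]
    [TopologicalSpace B] (A : Set X) (p : C(E, B)) : C(C(X, E), PullbackHom A p) :=
  ⟨fun f => ⟨(f.restrict A, p.comp f), rfl⟩, by
    refine Continuous.subtype_mk (Continuous.prodMk ?_ ?_) _
    · exact ContinuousMap.continuous_restrict A
    · exact ContinuousMap.continuous_postcomp p⟩

/-- Pullback-homs with boundary inclusions of cubes lift against boundary inclusions of cubes,
because the product of two cubes is a cube. -/
theorem LiftsCubes.toPullbackHom {E B : Type v} [TopologicalSpace E] [TopologicalSpace B]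
    {p : C(E, B)} (hp : LiftsCubes p) (n : ℕ) :
    LiftsCubes (toPullbackHom (Cube.boundary (Fin n)) p) := by
  classical
  have hBc := isClosed_cubeBoundary n
  have : CompactSpace (Cube.boundary (Fin n)) := isCompact_iff_compactSpace.1 hBc.isCompact
  refine ⟨?_, fun m f H hf hH hfH => ?_⟩
  · rintro ⟨⟨u, h⟩, huh⟩
    obtain ⟨e, -⟩ := hp.1 (h 0)
    obtain ⟨G, hG, hGu, hGh⟩ := hp.2 n
      (fun s => if hs : s ∈ Cube.boundary (Fin n) then u ⟨s, hs⟩ else e) h (by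
        rw [continuousOn_iff_continuous_domRestrict]
        convert! u.continuous using 2 with s
        simp) h.continuous fun s hs => by
          simpa [hs] using DFunLike.congr_fun huh ⟨s, hs⟩
    refine ⟨⟨G, hG⟩, Subtype.ext (Prod.ext (ContinuousMap.ext fun s => ?_)
      (ContinuousMap.ext hGh))⟩
    exact (hGu s s.2).trans (by simp)
  · let U : (Fin m → I) × (Fin n → I) → E := fun z =>
      if hs : z.2 ∈ Cube.boundary (Fin n) then (H z.1).1.1 ⟨z.2, hs⟩ else f z.1 z.2
    have hUH : ∀ z (hs : z.2 ∈ Cube.boundary (Fin n)), U z = (H z.1).1.1 ⟨z.2, hs⟩ :=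
      fun z hs => dif_pos hs
    have hUf : ∀ z : (Fin m → I) × (Fin n → I), z.1 ∈ Cube.boundary (Fin m) → U z = f z.1 z.2 := by
      intro z hz
      by_cases hs : z.2 ∈ Cube.boundary (Fin n)
      · rw [hUH z hs, ← hfH z.1 hz]; rfl
      · exact dif_neg hs
    have hUc : ContinuousOn U {z | z.1 ∈ Cube.boundary (Fin m) ∨ z.2 ∈ Cube.boundary (Fin n)} := by
      refine ContinuousOn.union_of_isClosed
        (s := {z : (Fin m → I) × (Fin n → I) | z.1 ∈ Cube.boundary (Fin m)})
        (t := {z | z.2 ∈ Cube.boundary (Fin n)}) ?_ ?_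
        ((isClosed_cubeBoundary m).preimage continuous_fst) (hBc.preimage continuous_snd)
      · refine ContinuousOn.congr (f := fun z => f z.1 z.2) ?_ fun z hz => hUf z hz
        have h1 : ContinuousOn (fun z : (Fin m → I) × (Fin n → I) => f z.1)
          {z | z.1 ∈ Cube.boundary (Fin m)} := hf.comp continuousOn_fst fun z hz => hz
        exact h1.eval continuousOn_snd
      · rw [continuousOn_iff_continuous_domRestrict]
        have : Continuous fun z : {z : (Fin m → I) × (Fin n → I) // z.2 ∈ Cube.boundary (Fin n)} =>
            (H z.1.1).1.1 ⟨z.1.2, z.2⟩ :=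
          (show Continuous fun z : {z : (Fin m → I) × (Fin n → I) // z.2 ∈ Cube.boundary (Fin n)} =>
            (H z.1.1).1.1 from by fun_prop).eval (by fun_prop)
        exact this.congr fun z => (hUH z.1 z.2).symm
    obtain ⟨G, hG, hGU, hGH⟩ := hp.liftsRel ((isCubePair_boundary m).prod (isCubePair_boundary n))
      U (fun z => (H z.1).1.2 z.2) hUc (by fun_prop) (by
        rintro ⟨s, t⟩ hst
        by_cases ht : t ∈ Cube.boundary (Fin n)
        · rw [hUH _ ht]
          exact DFunLike.congr_fun (H s).2 ⟨t, ht⟩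
        · have hs := hst.resolve_right ht
          rw [hUf _ hs, ← hfH s hs]
          rfl)
    refine ⟨ContinuousMap.curry ⟨G, hG⟩, (ContinuousMap.curry ⟨G, hG⟩).continuous,
      fun s hs => ContinuousMap.ext fun t => ?_, fun s => Subtype.ext (Prod.ext
        (ContinuousMap.ext fun t => ?_) (ContinuousMap.ext fun t => hGH (s, t)))⟩
    · exact (hGU (s, t) (Or.inl hs)).trans (hUf _ hs)
    · exact (hGU (s, t) (Or.inr t.2)).trans (hUH _ t.2)

/-- If `L` is Serre cofibrant, then `L × ∂I^n → L × I^n` has the left lifting property with respect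
to trivial Serre fibrations. Maps out of products with cubes are given in curried form. -/
theorem IsSerreCofibrant.exists_lift {L E B : Type v} [TopologicalSpace L] [TopologicalSpace E]
    [TopologicalSpace B] (hL : IsSerreCofibrant L) {p : C(E, B)} (hp : LiftsCubes p) (n : ℕ)
    (u : C(L, C(Cube.boundary (Fin n), E))) (h : C(L, C(Fin n → I, B)))
    (huh : ∀ l s, p (u l s) = h l s) :
    ∃ G : C(L, C(Fin n → I, E)), (∀ l s, G l s.1 = u l s) ∧ ∀ l s, p (G l s) = h l s := by
  obtain ⟨G, hG⟩ := hL _ _ _ (hp.toPullbackHom n).isTrivialSerreFibration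
    ⟨fun l => ⟨(u l, h l), ContinuousMap.ext (huh l)⟩,
      (u.continuous.prodMk h.continuous).subtype_mk _⟩
  have hG' := fun l => Subtype.ext_iff.1 (hG l)
  exact ⟨G, fun l s => DFunLike.congr_fun (congrArg Prod.fst (hG' l)) s,
    fun l s => DFunLike.congr_fun (congrArg Prod.snd (hG' l)) s⟩

/-! ### Continuity of compositions, sums and liftings to products -/

theorem Continuous.toCompactlyGenerated {X Y : Type v} [TopologicalSpace X]
    [CompactlyGeneratedSpace X] [TopologicalSpace Y] {f : X → Y} (hf : Continuous f) :
    Continuous[_, TopologicalSpace.compactlyGenerated.{v} Y] f := by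
  refine @continuous_from_uCompactlyGeneratedSpace.{v} X Y _
    (TopologicalSpace.compactlyGenerated.{v} Y) _ f fun S g => ?_
  let F : (Σ (i : (S : CompHaus.{v}) × C(S, Y)), i.fst) → Y := fun ⟨⟨_, i⟩, s⟩ => i s
  have h : Continuous[_, TopologicalSpace.compactlyGenerated.{v} Y] F := continuous_coinduced_rng
  exact (@continuous_sigma_iff _ _ _ _ (TopologicalSpace.compactlyGenerated.{v} Y) _).1 h
    ⟨S, ⟨f ∘ g, hf.comp g.continuous⟩⟩

theorem cgContinuous_of_compact {X Y : Type v} [TopologicalSpace X] [TopologicalSpace Y]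
    {f : X → Y} (h : ∀ (S : Type v) [TopologicalSpace S] [CompactSpace S] [T2Space S] (g : S → X),
      Continuous g → Continuous fun s => f (g s)) : CGContinuous f :=
  continuous_from_compactlyGenerated _ fun S g => h S g g.continuous

theorem CompactlyGeneratedSpace.continuous_of_compact {X Y : Type v} [TopologicalSpace X]
    [CompactlyGeneratedSpace X] [TopologicalSpace Y] {f : X → Y}
    (h : ∀ (S : Type v) [TopologicalSpace S] [CompactSpace S] [T2Space S] (g : S → X),
      Continuous g → Continuous fun s => f (g s)) : Continuous f :=
  continuous_from_uCompactlyGeneratedSpace.{v} _ fun S g => h S g g.continuous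

theorem IsHomeomorph.continuous_of_rightInverse {X Y : Type*} [TopologicalSpace X]
    [TopologicalSpace Y] {f : X → Y} (hf : IsHomeomorph f) {g : Y → X}
    (hg : Function.RightInverse g f) : Continuous g := by
  have h : g = (hf.homeomorph f).symm :=
    funext fun y => ((hf.homeomorph f).symm_apply_eq.2 (hg y).symm).symm
  rw [h]
  exact (hf.homeomorph f).symm.continuous

section Hom

variable {T : Type u} [Category.{v} T]

theorem PointedTopCategory.continuous_homComp [PointedTopCategory T] {K : Type v}
    [TopologicalSpace K] [CompactlyGeneratedSpace K] {X Y Z : T} {f : K → (X ⟶ Y)}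
    {g : K → (Y ⟶ Z)} (hf : Continuous f) (hg : Continuous g) :
    Continuous fun k => f k ≫ g k :=
  (continuous_comp X Y Z).comp_continuous (hf.prodMk hg)

theorem LeftLinearTopCategory.continuous_add [LeftLinearTopCategory T] {K : Type v}
    [TopologicalSpace K] [CompactlyGeneratedSpace K] {X Y : T} {f g : K → (X ⟶ Y)}
    (hf : Continuous f) (hg : Continuous g) : Continuous fun k => f k + g k :=
  (continuous_homAdd X Y).comp_continuous (hf.prodMk hg)

theorem LeftLinearTopCategory.comp_add' [LeftLinearTopCategory T] {X Y Z : T} (y : X ⟶ Y)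
    (x x' : Y ⟶ Z) : y ≫ (x + x') = y ≫ x + y ≫ x' := comp_homAdd y x x'

namespace IsEnrichedProduct

variable [PointedTopCategory T] {n : ℕ} {A : Fin n → T} {P : T} {p : ∀ i, P ⟶ A i}

theorem bijective (h : IsEnrichedProduct A P p) (X : T) :
    Function.Bijective fun (f : X ⟶ P) i => f ≫ p i :=
  @IsHomeomorph.bijective _ _ _ (TopologicalSpace.compactlyGenerated.{v} (∀ i, X ⟶ A i)) _ (h X)

/-- The morphism into a product with given components. -/
noncomputable def lift (h : IsEnrichedProduct A P p) {X : T} (x : ∀ i, X ⟶ A i) : X ⟶ P :=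
  ((h.bijective X).2 x).choose

theorem lift_comp (h : IsEnrichedProduct A P p) {X : T} (x : ∀ i, X ⟶ A i) (i : Fin n) :
    h.lift x ≫ p i = x i :=
  congrFun ((h.bijective X).2 x).choose_spec i

theorem hom_ext (h : IsEnrichedProduct A P p) {X : T} {f g : X ⟶ P}
    (hfg : ∀ i, f ≫ p i = g ≫ p i) : f = g :=
  (h.bijective X).1 (funext hfg)

theorem comp_lift (h : IsEnrichedProduct A P p) {X Y : T} (f : Y ⟶ X) (x : ∀ i, X ⟶ A i) :
    f ≫ h.lift x = h.lift fun i => f ≫ x i :=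
  h.hom_ext fun i => by simp [lift_comp]

theorem continuous_lift (h : IsEnrichedProduct A P p) {X : T} {K : Type v} [TopologicalSpace K]
    [CompactlyGeneratedSpace K] {x : K → ∀ i, X ⟶ A i} (hx : Continuous x) :
    Continuous fun k => h.lift (x k) := by
  have hc : CGContinuous fun x : ∀ i, X ⟶ A i => h.lift x :=
    @IsHomeomorph.continuous_of_rightInverse _ _ _
      (TopologicalSpace.compactlyGenerated.{v} (∀ i, X ⟶ A i)) _ (h X) _
      fun x => funext fun i => h.lift_comp x i
  exact hc.comp_continuous hx

/-- The product of `n + 1` copies of `A` is the product of `n` copies of `A` with `A`. -/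
theorem isEnrichedBinaryProduct_pow {A P P' : T} {p : Fin (n + 1) → (P ⟶ A)}
    {p' : Fin n → (P' ⟶ A)} (h : IsEnrichedProduct (fun _ => A) P p)
    (h' : IsEnrichedProduct (fun _ => A) P' p') :
    IsEnrichedBinaryProduct P (h'.lift fun i => p i.castSucc) (p (Fin.last n)) := by
  intro X
  let g : (X ⟶ P') × (X ⟶ A) → (X ⟶ P) := fun z =>
    h.lift (Fin.snoc (α := fun _ => X ⟶ A) (fun i => z.1 ≫ p' i) z.2)
  have hg : CGContinuous g := by
    refine cgContinuous_of_compact fun S _ _ _ k hk => h.continuous_lift ?_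
    refine continuous_pi fun i => ?_
    induction i using Fin.lastCases with
    | last => simpa [Function.comp_def] using continuous_snd.comp hk
    | cast i =>
      simpa using PointedTopCategory.continuous_homComp (continuous_fst.comp hk)
        (continuous_const (y := p' i))
  have hf : Continuous fun f : X ⟶ P => (f ≫ h'.lift (fun i => p i.castSucc), f ≫ p (Fin.last n)) :=
    (PointedTopCategory.continuous_homComp continuous_id continuous_const).prodMk
      (PointedTopCategory.continuous_homComp continuous_id continuous_const)
  refine (@isHomeomorph_iff_exists_inverse _ _ _
    (TopologicalSpace.compactlyGenerated.{v} ((X ⟶ P') × (X ⟶ A))) _).2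
    ⟨hf.toCompactlyGenerated, g, fun f => ?_, fun z => ?_, hg⟩
  · refine h.hom_ext fun i => ?_
    rw [lift_comp]
    induction i using Fin.lastCases with
    | last => simp
    | cast i => simp [lift_comp]
  · refine Prod.ext (h'.hom_ext fun i => ?_) ?_
    · simp [g, lift_comp]
    · simp [g, lift_comp]

end IsEnrichedProduct

/-- Restriction along the inclusions of the factors, `T(A^n, Z) → T(A, Z)^n`. -/
noncomputable def restrictionToFactors [PointedTopCategory T] {n : ℕ} {A P : T}
    {p : Fin n → (P ⟶ A)} (h : IsEnrichedProduct (fun _ => A) P p) (Z : T) :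
    C(P ⟶ Z, Fin n → (A ⟶ Z)) :=
  ⟨fun f k => h.lift (Pi.single k (𝟙 A)) ≫ f,
    continuous_pi fun _ => PointedTopCategory.continuous_precomp _ _⟩

theorem IsWeaklyBilinearMappingTheory.liftsCubes_restrictionToFactors [LeftLinearTopCategory T]
    (hT : IsWeaklyBilinearMappingTheory T) {n : ℕ} {A P : T} {p : Fin n → (P ⟶ A)}
    (h : IsEnrichedProduct (fun _ => A) P p) (Z : T) :
    LiftsCubes (restrictionToFactors h Z) := by
  induction n generalizing P with
  | zero =>
    -- The empty product is a zero object.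
    have hsub : ∀ f g : P ⟶ Z, f = g := fun f g => by
      have h0 : 𝟙 P = 0 := h.hom_ext fun i => i.elim0
      rw [← Category.id_comp f, ← Category.id_comp g, h0, zero_comp, zero_comp]
    exact ⟨fun w => ⟨0, Subsingleton.elim _ _⟩, fun m f H _ _ _ =>
      ⟨fun _ => 0, continuous_const, fun a _ => hsub _ _, fun x => Subsingleton.elim _ _⟩⟩
  | succ n ih =>
    obtain ⟨P', p', h'⟩ := hT.hasFiniteProducts n fun _ => A
    let iA : P' ⟶ P := h.lift (Fin.snoc (α := fun _ => P' ⟶ A) p' 0)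
    let iB : A ⟶ P := h.lift (Pi.single (Fin.last n) (𝟙 A))
    have hbin : LiftsCubes (restrictionMap iA iB Z) :=
      (hT.trivialFibration P' A Z P _ _ (h.isEnrichedBinaryProduct_pow h') iA iB
        (h'.hom_ext fun i => by simp [iA, IsEnrichedProduct.lift_comp])
        (by simp [iA, IsEnrichedProduct.lift_comp])
        (h'.hom_ext fun i => by simp [iB, IsEnrichedProduct.lift_comp, (Fin.castSucc_lt_last i).ne])
        (by simp [iB, IsEnrichedProduct.lift_comp])).liftsCubes
    let e : (Fin n → (A ⟶ Z)) × (A ⟶ Z) ≃ₜ (Fin (n + 1) → (A ⟶ Z)) :=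
      ((Homeomorph.refl _).prodCongr (Homeomorph.funUnique (Fin 1) _).symm).trans
        (Fin.appendHomeomorph n 1)
    have hcomp := e.liftsCubes.comp
      ((ih h').prodMap_id.comp hbin (restrictionMap iA iB Z).continuous)
      ((restrictionToFactors h' Z).continuous.prodMap continuous_id |>.comp
        (restrictionMap iA iB Z).continuous)
    convert! hcomp using 1
    funext f k
    induction k using Fin.lastCases with
    | last =>
      trans iB ≫ f
      · rfl
      · exact (Fin.append_right (restrictionToFactors h' Z (iA ≫ f)) (fun _ : Fin 1 => iB ≫ f) 0).symm
    | cast k =>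
      trans h'.lift (Pi.single k (𝟙 A)) ≫ iA ≫ f
      · rw [← Category.assoc]
        refine congrArg (· ≫ f) (h.hom_ext fun i => ?_)
        rw [IsEnrichedProduct.lift_comp, Category.assoc, IsEnrichedProduct.lift_comp]
        induction i using Fin.lastCases with
        | last => simp [(Fin.castSucc_lt_last k).ne']
        | cast i =>
          simp only [Fin.snoc_castSucc, IsEnrichedProduct.lift_comp]
          simp [Pi.single_apply]
      · exact (Fin.append_left (restrictionToFactors h' Z (iA ≫ f)) (fun _ : Fin 1 => iB ≫ f) k).symm

end Hom

/-! ### Operations on sequences -/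

/-- The sequence with the entries `j` and `j + 1` replaced by their sum. -/
def contractAt {M : Type*} [Add M] (j : ℕ) (x : ℕ → M) : ℕ → M := fun i =>
  if i < j then x i else if i = j then x j + x (j + 1) else x (i + 1)

/-- The sequence with the entry `j` left out. -/
def skipAt {α : Type*} (j : ℕ) (t : ℕ → α) : ℕ → α := fun i => if i < j then t i else t (i + 1)

/-- The sequence with the first `k` entries left out. -/
def shiftBy {α : Type*} (k : ℕ) (x : ℕ → α) : ℕ → α := fun i => x (k + i)

/-- The continuation of a finite sequence by the constant value `d`. -/
def extendBy {α : Type*} (d : α) {n : ℕ} (x : Fin n → α) : ℕ → α := fun i =>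
  if h : i < n then x ⟨i, h⟩ else d

theorem extendBy_coe {α : Type*} (d : α) {n : ℕ} (x : Fin n → α) (i : Fin n) :
    extendBy d x i = x i := by simp [extendBy]

theorem extendBy_of_lt {α : Type*} (d : α) {n : ℕ} (x : Fin n → α) {i : ℕ} (h : i < n) :
    extendBy d x i = x ⟨i, h⟩ := by simp [extendBy, h]

theorem contractAt_contractAt {M : Type*} [AddSemigroup M] {j k : ℕ} (hjk : j < k) (x : ℕ → M) :
    contractAt (k - 1) (contractAt j x) = contractAt j (contractAt k x) := by
  obtain ⟨k, rfl⟩ : ∃ l, k = l + 1 := ⟨k - 1, by omega⟩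
  funext i
  rcases lt_trichotomy i j with h | rfl | h
  · simp [contractAt, h, show i < k by omega, show i < k + 1 by omega]
  · rcases (show i < k ∨ i = k by omega) with h | rfl
    · simp [contractAt, h, show i < k + 1 by omega]
    · simp [contractAt, add_assoc]
  · rcases lt_trichotomy i k with h' | rfl | h'
    · simp [contractAt, h', show ¬ i < j by omega, show i ≠ j by omega]
    · simp [contractAt, show ¬ i < j by omega, show i ≠ j by omega, show ¬ i + 1 < j by omega,
        show i + 1 ≠ j by omega]
    · simp [contractAt, show ¬ i < j by omega, show i ≠ j by omega, show ¬ i + 1 < j by omega,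
        show i + 1 ≠ j by omega, show ¬ i < k by omega, show i ≠ k by omega]

theorem skipAt_skipAt {α : Type*} {j k : ℕ} (hjk : j < k) (t : ℕ → α) :
    skipAt (k - 1) (skipAt j t) = skipAt j (skipAt k t) := by
  funext i
  unfold skipAt
  split_ifs <;> first | rfl | omega

theorem shiftBy_contractAt_of_lt {M : Type*} [Add M] {j k : ℕ} (hjk : j < k) (x : ℕ → M) :
    shiftBy k (contractAt j x) = shiftBy (k + 1) x := by
  funext i
  simp only [shiftBy, contractAt]
  rw [if_neg (by omega), if_neg (by omega)]
  congr 1; omega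

theorem shiftBy_skipAt_of_le {α : Type*} {j k : ℕ} (hjk : j ≤ k) (t : ℕ → α) :
    shiftBy k (skipAt j t) = shiftBy (k + 1) t := by
  funext i
  simp only [shiftBy, skipAt]
  rw [if_neg (by omega)]
  congr 1; omega

theorem shiftBy_contractAt_of_le {M : Type*} [Add M] {j k : ℕ} (hjk : j ≤ k) (x : ℕ → M) :
    shiftBy j (contractAt k x) = contractAt (k - j) (shiftBy j x) := by
  obtain ⟨k, rfl⟩ := Nat.exists_eq_add_of_le hjk
  funext i
  simp only [shiftBy, contractAt, Nat.add_sub_cancel_left, Nat.add_lt_add_iff_left,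
    Nat.add_left_cancel_iff, add_assoc]

theorem shiftBy_skipAt {α : Type*} {j k : ℕ} (hjk : j ≤ k) (t : ℕ → α) :
    shiftBy j (skipAt k t) = skipAt (k - j) (shiftBy j t) := by
  obtain ⟨k, rfl⟩ := Nat.exists_eq_add_of_le hjk
  funext i
  simp only [shiftBy, skipAt, Nat.add_sub_cancel_left, Nat.add_lt_add_iff_left, add_assoc]

theorem shiftBy_shiftBy {α : Type*} (j k : ℕ) (x : ℕ → α) :
    shiftBy k (shiftBy j x) = shiftBy (j + k) x := by
  funext i
  simp only [shiftBy, add_assoc]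

theorem contractAt_single {M : Type*} [AddMonoid M] (j k : ℕ) (x : M) :
    contractAt j (Pi.single k x) = Pi.single (if k ≤ j then k else k - 1) x := by
  funext i
  simp only [contractAt, Pi.single_apply]
  split_ifs <;> first | (exfalso; omega) | simp

theorem shiftBy_single {M : Type*} [Zero M] {j k : ℕ} (h : j ≤ k) (x : M) :
    shiftBy j (Pi.single k x) = Pi.single (k - j) x := by
  funext i
  simp only [shiftBy, Pi.single_apply]
  split_ifs <;> first | rfl | omega

theorem continuous_skipAt {α : Type*} [TopologicalSpace α] (j : ℕ) :
    Continuous (skipAt (α := α) j) :=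
  continuous_pi fun i => by unfold skipAt; split_ifs <;> fun_prop

theorem continuous_shiftBy {α : Type*} [TopologicalSpace α] (k : ℕ) :
    Continuous (shiftBy (α := α) k) :=
  continuous_pi fun i => by unfold shiftBy; fun_prop

theorem continuous_extendBy {α : Type*} [TopologicalSpace α] (d : α) (n : ℕ) :
    Continuous (extendBy (n := n) d) :=
  continuous_pi fun i => by unfold extendBy; split_ifs <;> fun_prop

/-- Dependent recursion: a sequence can be constructed term by term, if the condition on the `n`-th
term depends only on the terms up to `n` and can be met whenever the previous conditions are. -/
theorem exists_seq_of_step {D : ℕ → Type*} [∀ n, Nonempty (D n)] (Q : ∀ _ : ℕ, (∀ m, D m) → Prop)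
    (hloc : ∀ n Φ Ψ, (∀ m ≤ n, Φ m = Ψ m) → Q n Φ → Q n Ψ)
    (step : ∀ n Φ, (∀ m < n, Q m Φ) → ∃ d, Q n (Function.update Φ n d)) : ∃ Φ, ∀ n, Q n Φ := by
  have step' : ∀ n Φ, ∃ d, (∀ m < n, Q m Φ) → Q n (Function.update Φ n d) := fun n Φ => by
    by_cases h : ∀ m < n, Q m Φ
    · obtain ⟨d, hd⟩ := step n Φ h
      exact ⟨d, fun _ => hd⟩
    · exact ⟨Classical.arbitrary _, fun h' => absurd h' h⟩
  choose d hd using step'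
  let F : ℕ → ∀ m, D m := fun n =>
    Nat.rec (fun _ => Classical.arbitrary _) (fun n Φ => Function.update Φ n (d n Φ)) n
  have hFs : ∀ n, F (n + 1) = Function.update (F n) n (d n (F n)) := fun n => rfl
  have hF : ∀ n, ∀ m < n, Q m (F n) := by
    intro n
    induction n with
    | zero => intro m hm; omega
    | succ n ih =>
      intro m hm
      rw [hFs]
      rcases Nat.lt_succ_iff_lt_or_eq.1 hm with h | rfl
      · exact hloc m (F n) _ (fun l hl => by rw [Function.update_of_ne (by omega)]) (ih m h)
      · exact hd _ _ ih
  have hstable : ∀ n m, F (m + 1 + n) m = F (m + 1) m := by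
    intro n m
    induction n with
    | zero => rfl
    | succ n ih => rw [← add_assoc, hFs, Function.update_of_ne (by omega), ih]
  refine ⟨fun m => F (m + 1) m, fun n => hloc n (F (n + 1)) _ (fun m hm => ?_)
    (hF _ n (Nat.lt_succ_self n))⟩
  obtain ⟨l, rfl⟩ := Nat.exists_eq_add_of_le hm
  rw [show m + l + 1 = m + 1 + l by omega]
  exact hstable l m

/-! ### Families of universal cubes -/

section Family

variable {T : Type u} [Category.{v} T] [LeftLinearTopCategory T]

/-- A family of candidates for the universal cubes `φ_a^{p_0, …, p_n}`, for all `n` and all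
`a : A ⟶ B`, where `P n` stands for `A^{n+1}`. -/
abbrev CubeFamily (A B : T) (P : ℕ → T) : Type v := ∀ n, C(A ⟶ B, C(Fin n → I, P n ⟶ B))

variable {A B : T} {P : ℕ → T} {pr : ∀ n, Fin (n + 1) → (P n ⟶ A)}
  (hP : ∀ n, IsEnrichedProduct (fun _ => A) (P n) (pr n)) (Φ : CubeFamily A B P)

/-- The value at `t` of the cube `φ_a^{x_0, …, x_n}` that is determined by the universal cube. -/
noncomputable def cubeVal (n : ℕ) {X : T} (a : A ⟶ B) (x : Fin (n + 1) → (X ⟶ A))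
    (t : Fin n → I) : X ⟶ B :=
  (hP n).lift x ≫ Φ n a t

theorem continuous_cubeVal (n : ℕ) {X : T} {K : Type v} [TopologicalSpace K]
    [CompactlyGeneratedSpace K] {a : K → (A ⟶ B)} {x : K → Fin (n + 1) → (X ⟶ A)}
    {t : K → Fin n → I} (ha : Continuous a) (hx : Continuous x) (ht : Continuous t) :
    Continuous fun k => cubeVal hP Φ n (a k) (x k) (t k) :=
  PointedTopCategory.continuous_homComp ((hP n).continuous_lift hx) (by fun_prop)

/-- `cubeVal` with inputs and coordinates taken from infinite sequences, of which only the first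
`n + 1` and the first `n` terms matter. -/
noncomputable def seqVal (n : ℕ) {X : T} (a : A ⟶ B) (x : ℕ → (X ⟶ A)) (t : ℕ → I) : X ⟶ B :=
  cubeVal hP Φ n a (fun i => x i) fun i => t i

theorem cubeVal_eq_seqVal {n : ℕ} {X : T} (a : A ⟶ B) {x : Fin (n + 1) → (X ⟶ A)}
    {t : Fin n → I} {x' : ℕ → (X ⟶ A)} {t' : ℕ → I} (hx : ∀ i : Fin (n + 1), x i = x' i)
    (ht : ∀ i : Fin n, t i = t' i) : cubeVal hP Φ n a x t = seqVal hP Φ n a x' t' := by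
  rw [seqVal, funext hx, funext ht]

theorem seqVal_congr {n : ℕ} {X : T} (a : A ⟶ B) {x x' : ℕ → (X ⟶ A)} {t t' : ℕ → I}
    (hx : ∀ i ≤ n, x i = x' i) (ht : ∀ i < n, t i = t' i) :
    seqVal hP Φ n a x t = seqVal hP Φ n a x' t' :=
  cubeVal_eq_seqVal hP Φ a (fun i => hx i (by omega)) fun i => ht i i.2

theorem seqVal_congr_family {Φ Ψ : CubeFamily A B P} {n : ℕ} (h : Φ n = Ψ n) {X : T} (a : A ⟶ B)
    (x : ℕ → (X ⟶ A)) (t : ℕ → I) : seqVal hP Φ n a x t = seqVal hP Ψ n a x t := by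
  simp only [seqVal, cubeVal, h]

theorem comp_seqVal (n : ℕ) {X Y : T} (f : Y ⟶ X) (a : A ⟶ B) (x : ℕ → (X ⟶ A)) (t : ℕ → I) :
    f ≫ seqVal hP Φ n a x t = seqVal hP Φ n a (fun i => f ≫ x i) t := by
  simp only [seqVal, cubeVal, ← Category.assoc, IsEnrichedProduct.comp_lift]

/-- The value that the `n`-cube has to take at a point with `t j = 0`. -/
noncomputable def faceZero (n j : ℕ) {X : T} (a : A ⟶ B) (x : ℕ → (X ⟶ A)) (t : ℕ → I) : X ⟶ B :=
  seqVal hP Φ (n - 1) a (contractAt j x) (skipAt j t)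

/-- The value that the `n`-cube has to take at a point with `t j = 1`. -/
noncomputable def faceOne (n j : ℕ) {X : T} (a : A ⟶ B) (x : ℕ → (X ⟶ A)) (t : ℕ → I) : X ⟶ B :=
  seqVal hP Φ j a x t + seqVal hP Φ (n - 1 - j) a (shiftBy (j + 1) x) (shiftBy (j + 1) t)

/-- The conditions on the `n`-cubes, relative to the cubes of lower dimension. (The condition
`φ_a^x = a x` is the case `n = 0` of the wedge condition.) -/
structure IsGoodAt (n : ℕ) : Prop where
  zero : ∀ {X : T} (a : A ⟶ B) (x : ℕ → (X ⟶ A)) (t : ℕ → I) (j : ℕ), j < n → t j = 0 →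
    seqVal hP Φ n a x t = faceZero hP Φ n j a x t
  one : ∀ {X : T} (a : A ⟶ B) (x : ℕ → (X ⟶ A)) (t : ℕ → I) (j : ℕ), j < n → t j = 1 →
    seqVal hP Φ n a x t = faceOne hP Φ n j a x t
  wedge : ∀ {X : T} (a : A ⟶ B) (x : X ⟶ A) (t : ℕ → I) (k : ℕ), k ≤ n →
    seqVal hP Φ n a (Pi.single k x) t = x ≫ a

theorem faceZero_congr {n j : ℕ} (hj : j < n) {X : T} (a : A ⟶ B) {x x' : ℕ → (X ⟶ A)}
    {t t' : ℕ → I} (hx : ∀ i ≤ n, x i = x' i) (ht : ∀ i < n, t i = t' i) :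
    faceZero hP Φ n j a x t = faceZero hP Φ n j a x' t' := by
  refine seqVal_congr hP Φ a (fun i hi => ?_) fun i hi => ?_
  · simp only [contractAt]
    rw [hx i (by omega), hx (i + 1) (by omega), hx j (by omega), hx (j + 1) (by omega)]
  · simp only [skipAt]
    rw [ht i (by omega), ht (i + 1) (by omega)]

theorem faceOne_congr {n j : ℕ} (hj : j < n) {X : T} (a : A ⟶ B) {x x' : ℕ → (X ⟶ A)}
    {t t' : ℕ → I} (hx : ∀ i ≤ n, x i = x' i) (ht : ∀ i < n, t i = t' i) :
    faceOne hP Φ n j a x t = faceOne hP Φ n j a x' t' :=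
  congrArg₂ (· + ·) (seqVal_congr hP Φ a (fun i _ => hx i (by omega)) fun i _ => ht i (by omega))
    (seqVal_congr hP Φ a (fun i _ => hx _ (by omega)) fun i _ => ht _ (by omega))

theorem comp_faceZero (n j : ℕ) {X Y : T} (f : Y ⟶ X) (a : A ⟶ B) (x : ℕ → (X ⟶ A))
    (t : ℕ → I) : f ≫ faceZero hP Φ n j a x t = faceZero hP Φ n j a (fun i => f ≫ x i) t := by
  rw [faceZero, faceZero, comp_seqVal]
  congr 1
  funext i
  simp only [contractAt]
  split_ifs
  · rfl
  · exact LeftLinearTopCategory.comp_add' _ _ _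
  · rfl

theorem comp_faceOne (n j : ℕ) {X Y : T} (f : Y ⟶ X) (a : A ⟶ B) (x : ℕ → (X ⟶ A))
    (t : ℕ → I) : f ≫ faceOne hP Φ n j a x t = faceOne hP Φ n j a (fun i => f ≫ x i) t := by
  rw [faceOne, faceOne, LeftLinearTopCategory.comp_add', comp_seqVal, comp_seqVal]
  rfl

variable {Φ}

theorem seqVal_eq_zero {n : ℕ} (h : IsGoodAt hP Φ n) {X : T} (a : A ⟶ B) {x : ℕ → (X ⟶ A)}
    (hx : ∀ i ≤ n, x i = 0) (t : ℕ → I) : seqVal hP Φ n a x t = 0 := by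
  have := h.wedge a (0 : X ⟶ A) t 0 (Nat.zero_le n)
  rw [Limits.zero_comp] at this
  rw [← this]
  exact seqVal_congr hP Φ a (fun i hi => by rw [hx i hi]; simp) fun _ _ => rfl

theorem faceZero_eq_faceZero {n : ℕ} (h : ∀ m < n, IsGoodAt hP Φ m) {X : T} (a : A ⟶ B)
    (x : ℕ → (X ⟶ A)) (t : ℕ → I) {j k : ℕ} (hjk : j < k) (hk : k < n) (hj0 : t j = 0)
    (hk0 : t k = 0) : faceZero hP Φ n j a x t = faceZero hP Φ n k a x t := by
  have h' := h (n - 1) (by omega)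
  rw [faceZero, faceZero,
    h'.zero a _ _ (k - 1) (by omega) (by simp [skipAt, show ¬ k - 1 < j by omega,
      show k - 1 + 1 = k by omega, hk0]),
    h'.zero a _ _ j (by omega) (by simp [skipAt, hjk, hj0]), faceZero, faceZero,
    contractAt_contractAt hjk, skipAt_skipAt hjk]

theorem faceZero_eq_faceOne {n : ℕ} (h : ∀ m < n, IsGoodAt hP Φ m) {X : T} (a : A ⟶ B)
    (x : ℕ → (X ⟶ A)) (t : ℕ → I) {j k : ℕ} (hjk : j < k) (hk : k < n) (hj0 : t j = 0)
    (hk1 : t k = 1) : faceZero hP Φ n j a x t = faceOne hP Φ n k a x t := by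
  rw [faceZero, faceOne, (h (n - 1) (by omega)).one a _ _ (k - 1) (by omega) (by
      simp [skipAt, show ¬ k - 1 < j by omega, show k - 1 + 1 = k by omega, hk1]),
    (h k hk).zero a x t j hjk hj0, faceOne, faceZero, show k - 1 + 1 = k by omega,
    show n - 1 - 1 - (k - 1) = n - 1 - k by omega, shiftBy_contractAt_of_lt hjk,
    shiftBy_skipAt_of_le hjk.le]

theorem faceOne_eq_faceZero {n : ℕ} (h : ∀ m < n, IsGoodAt hP Φ m) {X : T} (a : A ⟶ B)
    (x : ℕ → (X ⟶ A)) (t : ℕ → I) {j k : ℕ} (hjk : j < k) (hk : k < n) (hj1 : t j = 1)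
    (hk0 : t k = 0) : faceOne hP Φ n j a x t = faceZero hP Φ n k a x t := by
  rw [faceZero, (h (n - 1) (by omega)).one a _ _ j (by omega) (by simp [skipAt, hjk, hj1]),
    faceOne, faceOne, (h (n - 1 - j) (by omega)).zero a _ _ (k - (j + 1)) (by omega) (by
      simp [shiftBy, show j + 1 + (k - (j + 1)) = k by omega, hk0]),
    faceZero, shiftBy_contractAt_of_le hjk, shiftBy_skipAt hjk,
    show n - 1 - j - 1 = n - 1 - 1 - j by omega]
  congr 1
  exact seqVal_congr hP Φ a (fun i hi => by simp [contractAt, show i < k by omega])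
    fun i hi => by simp [skipAt, show i < k by omega]

theorem faceOne_eq_faceOne {n : ℕ} (h : ∀ m < n, IsGoodAt hP Φ m) {X : T} (a : A ⟶ B)
    (x : ℕ → (X ⟶ A)) (t : ℕ → I) {j k : ℕ} (hjk : j < k) (hk : k < n) (hj1 : t j = 1)
    (hk1 : t k = 1) : faceOne hP Φ n j a x t = faceOne hP Φ n k a x t := by
  rw [faceOne, faceOne, (h (n - 1 - j) (by omega)).one a _ _ (k - (j + 1)) (by omega) (by
      simp [shiftBy, show j + 1 + (k - (j + 1)) = k by omega, hk1]),
    (h k hk).one a x t j hjk hj1, faceOne, faceOne, shiftBy_shiftBy, shiftBy_shiftBy,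
    show j + 1 + (k - (j + 1) + 1) = k + 1 by omega,
    show n - 1 - j - 1 - (k - (j + 1)) = n - 1 - k by omega,
    show k - 1 - j = k - (j + 1) by omega, add_assoc]

theorem faceZero_single {n j k : ℕ} (h : ∀ m < n, IsGoodAt hP Φ m) (hj : j < n) (hk : k ≤ n)
    {X : T} (a : A ⟶ B) (x : X ⟶ A) (t : ℕ → I) :
    faceZero hP Φ n j a (Pi.single k x) t = x ≫ a := by
  rw [faceZero, contractAt_single]
  exact (h (n - 1) (by omega)).wedge a x _ _ (by split_ifs <;> omega)

theorem faceOne_single {n j k : ℕ} (h : ∀ m < n, IsGoodAt hP Φ m) (hj : j < n) (hk : k ≤ n)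
    {X : T} (a : A ⟶ B) (x : X ⟶ A) (t : ℕ → I) :
    faceOne hP Φ n j a (Pi.single k x) t = x ≫ a := by
  rw [faceOne]
  rcases le_or_gt k j with hkj | hkj
  · rw [(h j hj).wedge a x t k hkj, seqVal_eq_zero hP (h (n - 1 - j) (by omega)) a
      fun i _ => by simp [shiftBy, show j + 1 + i ≠ k by omega]]
    exact add_zero _
  · rw [seqVal_eq_zero hP (h j hj) a fun i hi => by
        simp [show i ≠ k by omega],
      shiftBy_single hkj, (h (n - 1 - j) (by omega)).wedge a x _ _ (by omega)]
    exact zero_add _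

variable (Φ)

open Classical in
/-- The prescribed values of the universal `n`-cube on the boundary; the faces are consistent, so
that it does not matter which of the faces through a point is chosen. -/
noncomputable def boundaryVal (n : ℕ) {X : T} (a : A ⟶ B) (x : ℕ → (X ⟶ A)) (t : ℕ → I) : X ⟶ B :=
  if h : ∃ j < n, t j = 0 then faceZero hP Φ n h.choose a x t
  else if h : ∃ j < n, t j = 1 then faceOne hP Φ n h.choose a x t
  else 0

variable {Φ}

theorem boundaryVal_of_eq_zero {n j : ℕ} (h : ∀ m < n, IsGoodAt hP Φ m) {X : T} (a : A ⟶ B)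
    (x : ℕ → (X ⟶ A)) {t : ℕ → I} (hj : j < n) (htj : t j = 0) :
    boundaryVal hP Φ n a x t = faceZero hP Φ n j a x t := by
  have h0 : ∃ j < n, t j = 0 := ⟨j, hj, htj⟩
  rw [boundaryVal, dif_pos h0]
  obtain ⟨hk, htk⟩ := h0.choose_spec
  rcases lt_trichotomy h0.choose j with hlt | heq | hlt
  · exact faceZero_eq_faceZero hP h a x t hlt hj htk htj
  · rw [heq]
  · exact (faceZero_eq_faceZero hP h a x t hlt hk htj htk).symm

theorem boundaryVal_of_eq_one {n j : ℕ} (h : ∀ m < n, IsGoodAt hP Φ m) {X : T} (a : A ⟶ B)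
    (x : ℕ → (X ⟶ A)) {t : ℕ → I} (hj : j < n) (htj : t j = 1) :
    boundaryVal hP Φ n a x t = faceOne hP Φ n j a x t := by
  by_cases h0 : ∃ j < n, t j = 0
  · obtain ⟨k, hk, htk⟩ := h0
    rw [boundaryVal_of_eq_zero hP h a x hk htk]
    rcases lt_trichotomy k j with hlt | rfl | hlt
    · exact faceZero_eq_faceOne hP h a x t hlt hj htk htj
    · exact absurd (htk.symm.trans htj) zero_ne_one
    · exact (faceOne_eq_faceZero hP h a x t hlt hk htj htk).symm
  · have h1 : ∃ j < n, t j = 1 := ⟨j, hj, htj⟩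
    rw [boundaryVal, dif_neg h0, dif_pos h1]
    obtain ⟨hk, htk⟩ := h1.choose_spec
    rcases lt_trichotomy h1.choose j with hlt | heq | hlt
    · exact faceOne_eq_faceOne hP h a x t hlt hj htk htj
    · rw [heq]
    · exact (faceOne_eq_faceOne hP h a x t hlt hk htj htk).symm

theorem continuous_seqVal (Φ : CubeFamily A B P) (n : ℕ) {X : T} {K : Type v} [TopologicalSpace K]
    [CompactlyGeneratedSpace K] {a : K → (A ⟶ B)} (x : ℕ → (X ⟶ A)) {t : K → ℕ → I}
    (ha : Continuous a) (ht : Continuous t) :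
    Continuous fun k => seqVal hP Φ n (a k) x (t k) :=
  continuous_cubeVal hP Φ n ha continuous_const (by fun_prop)

/-- The prescribed boundary values depend continuously on `a` and on the point of the boundary. -/
theorem continuous_boundaryVal {n : ℕ} (h : ∀ m < n, IsGoodAt hP Φ m) {X : T}
    (x : ℕ → (X ⟶ A)) {K : Type v} [TopologicalSpace K] [CompactlyGeneratedSpace K]
    {a : K → (A ⟶ B)} {t : K → ℕ → I} (ha : Continuous a) (ht : Continuous t)
    (hb : ∀ k, ∃ j < n, t k j = 0 ∨ t k j = 1) :
    Continuous fun k => boundaryVal hP Φ n (a k) x (t k) := by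
  let S : Fin n × Fin 2 → Set K := fun i => {k | t k i.1 = if i.2 = 0 then 0 else 1}
  refine (locallyFinite_of_finite S).continuous ?_ (fun i => ?_) fun i => ?_
  · refine Set.eq_univ_of_forall fun k => ?_
    obtain ⟨j, hj, h0 | h1⟩ := hb k
    · exact Set.mem_iUnion.2 ⟨(⟨j, hj⟩, 0), by simpa [S] using h0⟩
    · exact Set.mem_iUnion.2 ⟨(⟨j, hj⟩, 1), by simpa [S] using h1⟩
  · exact isClosed_eq (by fun_prop) continuous_const
  · obtain ⟨j, i⟩ := i
    rcases (show i = 0 ∨ i = 1 by omega) with rfl | rfl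
    · refine ContinuousOn.congr (f := fun k => faceZero hP Φ n j (a k) x (t k))
        (Continuous.continuousOn ?_)
        fun k hk => boundaryVal_of_eq_zero hP h _ x j.2 (by simpa [S] using hk)
      exact continuous_seqVal hP Φ _ _ ha ((continuous_skipAt _).comp ht)
    · refine ContinuousOn.congr (f := fun k => faceOne hP Φ n j (a k) x (t k))
        (Continuous.continuousOn ?_)
        fun k hk => boundaryVal_of_eq_one hP h _ x j.2 (by simpa [S] using hk)
      exact LeftLinearTopCategory.continuous_add (continuous_seqVal hP Φ _ _ ha ht)
        (continuous_seqVal hP Φ _ _ ha ((continuous_shiftBy _).comp ht))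

end Family

/-! ### Construction of the cubes -/

section Construction

variable {T : Type u} [Category.{v} T] [LeftLinearTopCategory T]
  {A B : T} {P : ℕ → T} {pr : ∀ n, Fin (n + 1) → (P n ⟶ A)}
  (hP : ∀ n, IsEnrichedProduct (fun _ => A) (P n) (pr n))

theorem IsGoodAt.of_eq {n : ℕ} {Φ Ψ : CubeFamily A B P} (hΦ : ∀ m ≤ n, Φ m = Ψ m)
    (h : IsGoodAt hP Φ n) : IsGoodAt hP Ψ n where
  zero a x t j hj htj := by
    rw [← seqVal_congr_family hP (hΦ n le_rfl), h.zero a x t j hj htj, faceZero, faceZero,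
      seqVal_congr_family hP (hΦ (n - 1) (by omega))]
  one a x t j hj htj := by
    rw [← seqVal_congr_family hP (hΦ n le_rfl), h.one a x t j hj htj, faceOne, faceOne,
      seqVal_congr_family hP (hΦ j (by omega)), seqVal_congr_family hP (hΦ (n - 1 - j) (by omega))]
  wedge a x t k hk := by
    rw [← seqVal_congr_family hP (hΦ n le_rfl), h.wedge a x t k hk]

/-- The `n`-cubes are constructed from the cubes of lower dimension. The conditions prescribe the
universal `n`-cube on the boundary of `I^n` and after restriction to the factors of `A^{n+1}`. This
is a lifting problem for `T(A, B) × ∂I^n → T(A, B) × I^n` and the trivial fibration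
`T(A^{n+1}, B) → T(A, B)^{n+1}`. -/
theorem exists_isGoodAt_update (hT : IsWeaklyBilinearMappingTheory T)
    (hL : IsSerreCofibrant (A ⟶ B)) (Φ : CubeFamily A B P) (n : ℕ)
    (h : ∀ m < n, IsGoodAt hP Φ m) : ∃ d, IsGoodAt hP (Function.update Φ n d) n := by
  have hcomp : CompactSpace (Cube.boundary (Fin n)) :=
    isCompact_iff_compactSpace.1 (isClosed_cubeBoundary n).isCompact
  let x₀ : ℕ → (P n ⟶ A) := extendBy 0 (pr n)
  have hb : ∀ s : Cube.boundary (Fin n), ∃ j < n, extendBy 0 s.1 j = 0 ∨ extendBy 0 s.1 j = 1 :=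
    fun ⟨s, i, hi⟩ => ⟨i, i.2, by simpa only [extendBy_coe] using hi⟩
  -- Naturality reduces the values at arbitrary inputs to those at the projections.
  have hnat : ∀ {X : T} (x : ℕ → (X ⟶ A)), ∀ i ≤ n,
      (hP n).lift (fun i => x i) ≫ x₀ i = x i := fun x i hi => by
    simp only [x₀, extendBy_of_lt _ _ (Nat.lt_succ_of_le hi)]
    exact (hP n).lift_comp _ _
  have hcont : ∀ (S : Type v) [TopologicalSpace S] [CompactSpace S] [T2Space S] (g : S → (A ⟶ B)),
      Continuous g → Continuous fun z : S × Cube.boundary (Fin n) =>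
        boundaryVal hP Φ n (g z.1) x₀ (extendBy 0 z.2.1) := fun S _ _ _ g hg =>
    continuous_boundaryVal hP h x₀ (K := S × Cube.boundary (Fin n)) (hg.comp continuous_fst)
      ((continuous_extendBy 0 n).comp (by fun_prop)) fun k => hb k.2
  let u : C(A ⟶ B, C(Cube.boundary (Fin n), P n ⟶ B)) :=
    ⟨fun a => ⟨fun s => boundaryVal hP Φ n a x₀ (extendBy 0 s.1), 
        (hcont PUnit (fun _ => a) continuous_const).comp (Continuous.prodMk_right PUnit.unit)⟩,
      CompactlyGeneratedSpace.continuous_of_compact fun S _ _ _ g hg =>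
        ContinuousMap.continuous_of_continuous_uncurry _ (hcont S g hg)⟩
  let c : C(A ⟶ B, C(Fin n → I, Fin (n + 1) → (A ⟶ B))) :=
    ContinuousMap.curry ⟨fun z _ => z.1, by fun_prop⟩
  obtain ⟨G, hGu, hGc⟩ := hL.exists_lift (hT.liftsCubes_restrictionToFactors (hP n) B) n u c (by
    intro a s
    funext k
    change (hP n).lift (Pi.single k (𝟙 A)) ≫ boundaryVal hP Φ n a x₀ (extendBy 0 s.1) = a
    have hx : ∀ i ≤ n, (hP n).lift (Pi.single k (𝟙 A)) ≫ x₀ i =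
        (Pi.single (k : ℕ) (𝟙 A) : ℕ → (A ⟶ A)) i := fun i hi => by
      simp only [x₀, extendBy_of_lt _ _ (Nat.lt_succ_of_le hi), IsEnrichedProduct.lift_comp]
      simp [Pi.single_apply, Fin.ext_iff]
    obtain ⟨j, hj, hj0 | hj1⟩ := hb s
    · rw [boundaryVal_of_eq_zero hP h a x₀ hj hj0, comp_faceZero,
        faceZero_congr hP Φ hj a hx fun _ _ => rfl,
        faceZero_single hP h hj (Nat.lt_succ_iff.1 k.2), Category.id_comp]
    · rw [boundaryVal_of_eq_one hP h a x₀ hj hj1, comp_faceOne,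
        faceOne_congr hP Φ hj a hx fun _ _ => rfl,
        faceOne_single hP h hj (Nat.lt_succ_iff.1 k.2), Category.id_comp])
  have hlow : ∀ m < n, Function.update Φ n G m = Φ m := fun m hm =>
    Function.update_of_ne hm.ne _ _
  have hval : ∀ {X : T} (a : A ⟶ B) (x : ℕ → (X ⟶ A)) (t : ℕ → I),
      seqVal hP (Function.update Φ n G) n a x t =
        (hP n).lift (fun i => x i) ≫ G a fun i => t i := fun a x t => by
    rw [seqVal, cubeVal, Function.update_self]
  have ht : ∀ (t : ℕ → I), ∀ i < n, extendBy 0 (fun i : Fin n => t i) i = t i := fun t i hi =>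
    extendBy_of_lt _ _ hi
  refine ⟨G, fun a x t j hj htj => ?_, fun a x t j hj htj => ?_, fun a x t k hk => ?_⟩
  · rw [hval, hGu a ⟨fun i => t i, ⟨j, hj⟩, Or.inl htj⟩]
    change _ ≫ boundaryVal hP Φ n a x₀ _ = _
    rw [boundaryVal_of_eq_zero hP h a x₀ hj ((ht t j hj).trans htj), comp_faceZero,
      faceZero_congr hP Φ hj a (hnat x) (ht t), faceZero, faceZero,
      seqVal_congr_family hP (hlow (n - 1) (by omega))]
  · rw [hval, hGu a ⟨fun i => t i, ⟨j, hj⟩, Or.inr htj⟩]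
    change _ ≫ boundaryVal hP Φ n a x₀ _ = _
    rw [boundaryVal_of_eq_one hP h a x₀ hj ((ht t j hj).trans htj), comp_faceOne,
      faceOne_congr hP Φ hj a (hnat x) (ht t), faceOne, faceOne,
      seqVal_congr_family hP (hlow j hj), seqVal_congr_family hP (hlow (n - 1 - j) (by omega))]
  · have hG : (hP n).lift (Pi.single (⟨k, Nat.lt_succ_of_le hk⟩ : Fin (n + 1)) (𝟙 A)) ≫
        G a (fun i => t i) = a := congrFun (hGc a fun i => t i) ⟨k, Nat.lt_succ_of_le hk⟩
    rw [hval]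
    conv_rhs => rw [← hG, ← Category.assoc, IsEnrichedProduct.comp_lift]
    congr 2
    funext i
    simp only [Pi.single_apply, Fin.ext_iff]
    split_ifs <;> simp

theorem exists_isGoodAt (hT : IsWeaklyBilinearMappingTheory T) (hL : IsSerreCofibrant (A ⟶ B)) :
    ∃ Φ : CubeFamily A B P, ∀ n, IsGoodAt hP Φ n :=
  have : ∀ n, Nonempty C(A ⟶ B, C(Fin n → I, P n ⟶ B)) := fun _ => ⟨.const _ (.const _ 0)⟩
  exists_seq_of_step (fun n Φ => IsGoodAt hP Φ n) (fun _ _ _ hΦ h => h.of_eq hP hΦ)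
    fun n Φ => exists_isGoodAt_update hP hT hL Φ n

end Construction

theorem mainTheorem1 (T : Type u) [Category.{v} T] [LeftLinearTopCategory T]
    (hT : IsWeaklyBilinearMappingTheory T)
    (hcof : ∀ A B : T, IsSerreCofibrant (A ⟶ B)) :
    ∃ φ : InftyDistributor T, φ.IsGood := by
  choose P pr hP using fun (A : T) (n : ℕ) => hT.hasFiniteProducts (n + 1) fun _ => A
  choose Φ hΦ using fun A B : T => exists_isGoodAt (hP A) hT (hcof A B)
  have hcont : ∀ (n : ℕ) {X A B : T} {K : Type v} [TopologicalSpace K] [CompactlyGeneratedSpace K]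
      {a : K → (A ⟶ B)} {x : K → Fin (n + 1) → (X ⟶ A)} {t : K → Fin n → I} (_ : Continuous a)
      (_ : Continuous x) (_ : Continuous t),
      Continuous fun k => cubeVal (hP A) (Φ A B) n (a k) (x k) (t k) :=
    fun n => continuous_cubeVal (hP _) (Φ _ _) n
  have hseq : ∀ {n : ℕ} {X A B : T} (a : A ⟶ B) (x : Fin (n + 1) → (X ⟶ A)) (t : Fin n → I),
      cubeVal (hP A) (Φ A B) n a x t =
        seqVal (hP A) (Φ A B) n a (extendBy 0 x) (extendBy 0 t) := fun a x t =>
    cubeVal_eq_seqVal _ _ a (fun i => (extendBy_coe 0 x i).symm) fun i => (extendBy_coe 0 t i).symm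
  have hwedge : ∀ (n : ℕ) {X A B : T} (a : A ⟶ B) (x : X ⟶ A) (k : Fin (n + 1)) (t : Fin n → I),
      cubeVal (hP A) (Φ A B) n a (Pi.single k x) t = x ≫ a := fun n X A B a x k t => by
    rw [← (hΦ A B n).wedge a x (extendBy 0 t) k (Nat.lt_succ_iff.1 k.2)]
    refine cubeVal_eq_seqVal _ _ a (fun i => ?_) fun i => (extendBy_coe 0 t i).symm
    simp [Pi.single_apply, Fin.ext_iff]
  let φ : InftyDistributor T :=
    { cube := fun n X A B a x => ⟨fun t => cubeVal (hP A) (Φ A B) n a x t, by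
        unfold cubeVal
        exact (PointedTopCategory.continuous_precomp _ B).comp (Φ A B n a).continuous⟩
      cube_zero := fun {X A B} a x t => by
        change cubeVal (hP A) (Φ A B) 0 a x t = _
        rw [← hwedge 0 a (x 0) 0 t]
        congr 1
        funext i
        rw [Subsingleton.elim i 0, Pi.single_eq_same]
      cube_of_eq_zero := fun n {X A B} a x t j htj => by
        change cubeVal (hP A) (Φ A B) (n + 1) a x t = cubeVal (hP A) (Φ A B) n a _ _
        rw [hseq, (hΦ A B (n + 1)).zero a _ _ j j.2 ((extendBy_coe 0 t j).trans htj), faceZero]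
        refine (cubeVal_eq_seqVal _ _ a (fun i => ?_) fun i => ?_).symm
        · obtain ⟨i, hi⟩ := i
          simp only [Fin.contractNth, contractAt, Fin.val_castSucc]
          split_ifs
          · exact (extendBy_of_lt 0 x _).symm
          · subst i
            exact congrArg₂ (· + ·) (extendBy_of_lt 0 x _).symm (extendBy_of_lt 0 x _).symm
          · exact (extendBy_of_lt 0 x _).symm
        · simp only [Fin.removeNth, skipAt, Fin.succAbove, Fin.lt_def, Fin.val_castSucc]
          split_ifs
          · exact (extendBy_of_lt 0 t _).symm
          · exact (extendBy_of_lt 0 t _).symm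
      cube_of_eq_one := fun p q {X A B} a x t htp => by
        change cubeVal (hP A) (Φ A B) (p + q + 1) a x t =
          cubeVal (hP A) (Φ A B) p a _ _ + cubeVal (hP A) (Φ A B) q a _ _
        rw [hseq, (hΦ A B (p + q + 1)).one a _ _ p (by omega)
          ((extendBy_of_lt 0 t (by omega)).trans htp), faceOne,
          show p + q + 1 - 1 - p = q by omega]
        refine congrArg₂ (· + ·) (cubeVal_eq_seqVal _ _ a (fun i => ?_) fun i => ?_).symm
          (cubeVal_eq_seqVal _ _ a (fun i => ?_) fun i => ?_).symm
        · exact (extendBy_of_lt 0 x _).symm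
        · exact (extendBy_of_lt 0 t _).symm
        · exact (extendBy_of_lt 0 x _).symm
        · exact (extendBy_of_lt 0 t _).symm
      continuous_cube := fun n X A B => cgContinuous_of_compact fun S _ _ _ g hg =>
        ContinuousMap.continuous_of_continuous_uncurry _ (hcont n (K := S × (Fin n → I))
          (a := fun z => (g z.1).1) (x := fun z => (g z.1).2) (t := fun z => z.2)
          (by fun_prop) (by fun_prop) (by fun_prop)) }
  refine ⟨φ, fun n => ⟨fun {X A B Q} p _ a x f hf t => ?_, fun {X A B} a x k t => hwedge n a x k t⟩⟩
  change (hP A n).lift x ≫ Φ A B n a t = f ≫ (hP A n).lift p ≫ Φ A B n a t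
  rw [← Category.assoc, IsEnrichedProduct.comp_lift, funext hf]
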